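/- Let $(\mathscr{A},\mathbb{E},\mathfrak{s})$ be a Krull–Schmidt extriangulated category (in the sense of Nakaoka–Palu) with enough projectives and enough injectives, satisfying condition (WIC): if $gf$ is an inflation then so is $f$, and if $gf$ is a deflation then so is $g$. A *subcategory* of $\mathscr{A}$ means a full additive subcategory closed under isomorphisms and direct summands. Higher extension groups are defined by $\mathbb{E}^{i+1}(X,Y)=\mathbb{E}(X,\Sigma^iY)$ for $i\ge 0$, where $\Sigma Y$ denotes a cosyzygy of $Y$ (there is an $\mathbb{E}$-triangle $Y\to I\to\Sigma Y\dashrightarrow$ with $I$ injective). For a subcategory $\omega$ put $$\omega^\perp=\{Y\mid \mathbb{E}^i(X,Y)=0\ \ \forall i\ge 1,\ \forall X\in\omega\},\qquad {}^\perp\omega=\{Y\mid \mathbb{E}^i(Y,X)=0\ \ \forall i\ge 1,\ \forall X\in\omega\}.$$ Let $\mathcal{C}$ be a subcategory that is self-orthogonal, i.e. $\mathcal{C}\subseteq\mathcal{C}^\perp$. Let ${}_{\mathcal{C}}\mathcal{X}$ consist of all objects $A$ for which there are $\mathbb{E}$-triangles $K_{n+1}\to W_n\to K_n\dashrightarrow$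 for all $n\ge 0$, with $K_0=A$, all $W_n\in\mathcal{C}$ and all $K_n\in\mathcal{C}^\perp$. Write $\mathcal{Y}={}_{\mathcal{C}}\mathcal{X}$. By an *$\mathbb{E}$-triangle in $\mathcal{Y}$* we mean an $\mathbb{E}$-triangle of $\mathscr{A}$ all three of whose terms lie in $\mathcal{Y}$. Suppose that $\mathcal{Y}$ has a relative injective cogenerator: there is a subcategory $\mathcal{I}\subseteq\mathcal{Y}\cap\mathcal{Y}^\perp$ such that for every $Y\in\mathcal{Y}$ there is an $\mathbb{E}$-triangle $Y\to I\to Y'\dashrightarrow$ with $I\in\mathcal{I}$ and $Y'\in\mathcal{Y}$. A subcategory $\mathcal{B}\subseteq\mathcal{Y}$ is *relative resolving* in $\mathcal{Y}$ if, for every $\mathbb{E}$-triangle $A\to B\to C\dashrightarrow$ in $\mathcal{Y}$, $A,C\in\mathcal{B}$ implies $B\in\mathcal{B}$, and $B,C\in\mathcal{B}$ implies $A\in\mathcal{B}$; and $\mathcal{B}$ contains every object $P\in\mathcal{Y}$ that is projective in $\mathcal{Y}$ (for each $\mathbb{E}$-triangle $A\to B\to C\dashrightarrow$ in $\mathcal{Y}$,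 every morphism $P\to C$ factors through $B\to C$). Dually, a subcategory $\mathcal{D}\subseteq\mathcal{Y}$ is *relative coresolving* in $\mathcal{Y}$ if, for every $\mathbb{E}$-triangle $A\to B\to C\dashrightarrow$ in $\mathcal{Y}$, $A,C\in\mathcal{D}$ implies $B\in\mathcal{D}$, and $A,B\in\mathcal{D}$ implies $C\in\mathcal{D}$; and $\mathcal{D}$ contains every object of $\mathcal{Y}$ that is injective in $\mathcal{Y}$. A subcategory $\omega\subseteq\mathcal{Y}$ is *strongly contravariantly finite* (resp. *strongly covariantly finite*) in $\mathcal{Y}$ if for every $Y\in\mathcal{Y}$ there is an $\mathbb{E}$-triangle $K\to W\xrightarrow{g}Y\dashrightarrow$ (resp. $Y\xrightarrow{g}W\to V\dashrightarrow$) in $\mathcal{Y}$ in which $g$ is a right (resp. left) $\omega$-approximation of $Y$. Then the assignments $$\mathcal{D}\longmapsto{}^\perp\mathcal{D}\cap{}_{\mathcal{C}}\mathcal{X},\qquad \mathcal{B}\longmapsto\mathcal{B}^\perp\cap{}_{\mathcal{C}}\mathcal{X}$$ are mutually inverse bijections between the relative coresolving, strongly covariantly finite subcategories $\mathcal{D}$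 of ${}_{\mathcal{C}}\mathcal{X}$ and the relative resolving, strongly contravariantly finite subcategories $\mathcal{B}$ of ${}_{\mathcal{C}}\mathcal{X}$. -/

import Mathlib

open CategoryTheory CategoryTheory.Limits Opposite

universe w v u

namespace Extri

attribute [instance] hasBinaryBiproducts_of_finite_biproducts

/-! ## Sequences up to equivalence -/

/-- A sequence `A ⟶ B ⟶ C` with prescribed end terms. -/
structure Seq {𝒜 : Type u} [Category.{v} 𝒜] (A C : 𝒜) where
  B : 𝒜
  x : A ⟶ B
  y : B ⟶ C

/-- Two sequences `A ⟶ B ⟶ C` and `A ⟶ B' ⟶ C` are equivalent if there is an isomorphism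
`B ≅ B'` compatible with the identities of `A` and `C`. -/
def seqSetoid {𝒜 : Type u} [Category.{v} 𝒜] (A C : 𝒜) : Setoid (Seq A C) where
  r S S' := ∃ b : S.B ≅ S'.B, S.x ≫ b.hom = S'.x ∧ b.hom ≫ S'.y = S.y
  iseqv :=
    { refl := fun S => ⟨Iso.refl _, by simp, by simp⟩
      symm := by
        rintro S S' ⟨b, h1, h2⟩
        exact ⟨b.symm, by simp [← h1], by simp [← h2]⟩
      trans := by
        rintro S S' S'' ⟨b, h1, h2⟩ ⟨b', h1', h2'⟩
        exact ⟨b ≪≫ b', by simp [← h1', ← h1], by simp [← h2, ← h2']⟩ }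

/-- Equivalence classes `[A ⟶ B ⟶ C]`. -/
def SeqClass {𝒜 : Type u} [Category.{v} 𝒜] (A C : 𝒜) : Type (max u v) :=
  Quotient (seqSetoid A C)

/-- The class `[A ⟶ B ⟶ C]` of a sequence. -/
def seqClass {𝒜 : Type u} [Category.{v} 𝒜] {A B C : 𝒜} (x : A ⟶ B) (y : B ⟶ C) : SeqClass A C :=
  Quotient.mk (seqSetoid A C) ⟨B, x, y⟩

/-! ## Extriangulated categories -/

/-- The data `(𝔼, 𝔰)`: a biadditive functor `𝔼 : 𝒜ᵒᵖ × 𝒜 ⥤ Ab`, together with a map `𝔰`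
sending each `δ ∈ 𝔼(C, A)` to an equivalence class of sequences `A ⟶ B ⟶ C`. -/
structure PreExtriangulated (𝒜 : Type u) [Category.{v} 𝒜] [Preadditive 𝒜] where
  E : 𝒜ᵒᵖ ⥤ 𝒜 ⥤ AddCommGrpCat.{w}
  additive_left : E.Additive
  additive_right : ∀ X : 𝒜ᵒᵖ, (E.obj X).Additive
  s : ∀ {A C : 𝒜}, ((E.obj (op C)).obj A) → SeqClass A C

namespace PreExtriangulated

variable {𝒜 : Type u} [Category.{v} 𝒜] [Preadditive 𝒜] (T : PreExtriangulated.{w} 𝒜)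

/-- The abelian group `𝔼(C, A)` of extensions. -/
abbrev Ext (C A : 𝒜) : Type w := (T.E.obj (op C)).obj A

variable {T}

/-- `a_* δ ∈ 𝔼(C, A')` for `a : A ⟶ A'` and `δ ∈ 𝔼(C, A)`. -/
def push {A A' C : 𝒜} (a : A ⟶ A') (δ : T.Ext C A) : T.Ext C A' :=
  ((T.E.obj (op C)).map a).hom δ

/-- `c^* δ ∈ 𝔼(C', A)` for `c : C' ⟶ C` and `δ ∈ 𝔼(C, A)`. -/
def pull {A C C' : 𝒜} (c : C' ⟶ C) (δ : T.Ext C A) : T.Ext C' A :=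
  ((T.E.map c.op).app A).hom δ

/-- The sum `δ ⊕ δ' ∈ 𝔼(C ⊕ C', A ⊕ A')`: the element with components `(δ, 0, 0, δ')`. -/
noncomputable def dsum [HasFiniteBiproducts 𝒜] {A A' C C' : 𝒜} (δ : T.Ext C A) (δ' : T.Ext C' A') :
    T.Ext (C ⊞ C') (A ⊞ A') :=
  push biprod.inl (pull biprod.fst δ) + push biprod.inr (pull biprod.snd δ')

/-- `A ⟶ B ⟶ C` realizes `δ`, i.e. `A ⟶ B ⟶ C ⇢ δ` is an `𝔼`-triangle. -/
def Tri {A B C : 𝒜} (x : A ⟶ B) (y : B ⟶ C) (δ : T.Ext C A) : Prop :=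
  T.s δ = seqClass x y

end PreExtriangulated

open PreExtriangulated

/-- An extriangulated structure (Nakaoka-Palu) on an additive category. -/
structure Extriangulated (𝒜 : Type u) [Category.{v} 𝒜] [Preadditive 𝒜] [HasFiniteBiproducts 𝒜]
    extends PreExtriangulated.{w} 𝒜 where
  /-- `𝔰` is a realization. -/
  realization : ∀ {A B C A' B' C' : 𝒜} {x : A ⟶ B} {y : B ⟶ C} {x' : A' ⟶ B'} {y' : B' ⟶ C'}
    {δ : toPreExtriangulated.Ext C A} {δ' : toPreExtriangulated.Ext C' A'},
    Tri x y δ → Tri x' y' δ' → ∀ (a : A ⟶ A') (c : C ⟶ C'), push a δ = pull c δ' →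
      ∃ b : B ⟶ B', x ≫ b = a ≫ x' ∧ y ≫ c = b ≫ y'
  /-- The split extension is realized by the split sequence. -/
  realize_zero : ∀ A C : 𝒜,
    Tri (biprod.inl : A ⟶ A ⊞ C) (biprod.snd : A ⊞ C ⟶ C) (0 : toPreExtriangulated.Ext C A)
  /-- `𝔰(δ ⊕ δ') = 𝔰(δ) ⊕ 𝔰(δ')`. -/
  realize_dsum : ∀ {A B C A' B' C' : 𝒜} {x : A ⟶ B} {y : B ⟶ C} {x' : A' ⟶ B'} {y' : B' ⟶ C'}
    {δ : toPreExtriangulated.Ext C A} {δ' : toPreExtriangulated.Ext C' A'},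
    Tri x y δ → Tri x' y' δ' → Tri (biprod.map x x') (biprod.map y y') (dsum δ δ')
  /-- (ET3) -/
  et3 : ∀ {A B C A' B' C' : 𝒜} {x : A ⟶ B} {y : B ⟶ C} {x' : A' ⟶ B'} {y' : B' ⟶ C'}
    {δ : toPreExtriangulated.Ext C A} {δ' : toPreExtriangulated.Ext C' A'},
    Tri x y δ → Tri x' y' δ' → ∀ (a : A ⟶ A') (b : B ⟶ B'), x ≫ b = a ≫ x' →
      ∃ c : C ⟶ C', push a δ = pull c δ' ∧ y ≫ c = b ≫ y'
  /-- (ET3)ᵒᵖ -/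
  et3_op : ∀ {A B C A' B' C' : 𝒜} {x : A ⟶ B} {y : B ⟶ C} {x' : A' ⟶ B'} {y' : B' ⟶ C'}
    {δ : toPreExtriangulated.Ext C A} {δ' : toPreExtriangulated.Ext C' A'},
    Tri x y δ → Tri x' y' δ' → ∀ (b : B ⟶ B') (c : C ⟶ C'), y ≫ c = b ≫ y' →
      ∃ a : A ⟶ A', push a δ = pull c δ' ∧ x ≫ b = a ≫ x'
  /-- (ET4) -/
  et4 : ∀ {A B C D F : 𝒜} {f : A ⟶ B} {f' : B ⟶ D} {g : B ⟶ C} {g' : C ⟶ F}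
    {δ : toPreExtriangulated.Ext D A} {δ' : toPreExtriangulated.Ext F B},
    Tri f f' δ → Tri g g' δ' →
      ∃ (G : 𝒜) (h' : C ⟶ G) (d : D ⟶ G) (e : G ⟶ F) (δ'' : toPreExtriangulated.Ext G A),
        f' ≫ d = g ≫ h' ∧ h' ≫ e = g' ∧ Tri (f ≫ g) h' δ'' ∧
        Tri d e (push f' δ') ∧ pull d δ'' = δ ∧ push f δ'' = pull e δ'
  /-- (ET4)ᵒᵖ -/
  et4_op : ∀ {A B C D F : 𝒜} {f' : D ⟶ A} {f : A ⟶ B} {g' : F ⟶ B} {g : B ⟶ C}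
    {δ : toPreExtriangulated.Ext B D} {δ' : toPreExtriangulated.Ext C F},
    Tri f' f δ → Tri g' g δ' →
      ∃ (G : 𝒜) (h' : G ⟶ A) (d : D ⟶ G) (e : G ⟶ F) (δ'' : toPreExtriangulated.Ext C G),
        d ≫ h' = f' ∧ e ≫ g' = h' ≫ f ∧ Tri h' (f ≫ g) δ'' ∧
        Tri d e (pull g' δ) ∧ push e δ'' = δ' ∧ push d δ = pull g δ''

/-- A Krull-Schmidt category: every object is a finite direct sum of objects with local
endomorphism rings. -/
def IsKrullSchmidt (𝒜 : Type u) [Category.{v} 𝒜] [Preadditive 𝒜] [HasFiniteBiproducts 𝒜] : Prop :=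
  ∀ A : 𝒜, ∃ (n : ℕ) (X : Fin n → 𝒜), (∀ i, IsLocalRing (End (X i))) ∧ Nonempty (A ≅ ⨁ X)

/-- A subcategory: a full additive subcategory (given by its objects) closed under isomorphisms
and direct summands. -/
structure IsSubcategory {𝒜 : Type u} [Category.{v} 𝒜] [Preadditive 𝒜] [HasFiniteBiproducts 𝒜]
    (P : ObjectProperty 𝒜) : Prop where
  zero : ∀ Z : 𝒜, IsZero Z → P Z
  iso : ∀ {X Y : 𝒜}, (X ≅ Y) → P X → P Y
  sum : ∀ {X Y : 𝒜}, P X → P Y → P (X ⊞ Y)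
  summand : ∀ {X Y : 𝒜}, P (X ⊞ Y) → P X

namespace Extriangulated

variable {𝒜 : Type u} [Category.{v} 𝒜] [Preadditive 𝒜] [HasFiniteBiproducts 𝒜]
  (T : Extriangulated.{w} 𝒜)

/-- `A ⟶ B ⟶ C` is a conflation. -/
def Conflation {A B C : 𝒜} (x : A ⟶ B) (y : B ⟶ C) : Prop :=
  ∃ δ : T.Ext C A, Tri x y δ

/-- `x` is an inflation. -/
def Inflation {A B : 𝒜} (x : A ⟶ B) : Prop := ∃ (C : 𝒜) (y : B ⟶ C), T.Conflation x y

/-- `y` is a deflation. -/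
def Deflation {B C : 𝒜} (y : B ⟶ C) : Prop := ∃ (A : 𝒜) (x : A ⟶ B), T.Conflation x y

/-- The condition (WIC). -/
def WIC : Prop :=
  (∀ {A B C : 𝒜} (f : A ⟶ B) (g : B ⟶ C), T.Inflation (f ≫ g) → T.Inflation f) ∧
  (∀ {A B C : 𝒜} (f : A ⟶ B) (g : B ⟶ C), T.Deflation (f ≫ g) → T.Deflation g)

/-- `Proj(𝒴)`: the projective objects of the (extension-closed) subcategory `𝒴`, whose
`𝔼`-triangles are those of `𝒜` with all three terms in `𝒴`. -/
def projIn (𝒴 : ObjectProperty 𝒜) : ObjectProperty 𝒜 := fun P =>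
  𝒴 P ∧ ∀ {A B C : 𝒜} (x : A ⟶ B) (y : B ⟶ C), 𝒴 A → 𝒴 B → 𝒴 C → T.Conflation x y →
    ∀ c : P ⟶ C, ∃ b : P ⟶ B, b ≫ y = c

/-- `Inj(𝒴)`: the injective objects of the (extension-closed) subcategory `𝒴`. -/
def injIn (𝒴 : ObjectProperty 𝒜) : ObjectProperty 𝒜 := fun I =>
  𝒴 I ∧ ∀ {A B C : 𝒜} (x : A ⟶ B) (y : B ⟶ C), 𝒴 A → 𝒴 B → 𝒴 C → T.Conflation x y →
    ∀ a : A ⟶ I, ∃ b : B ⟶ I, x ≫ b = a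

/-- Enough projectives (`projIn ⊤` being the projective objects of `𝒜`). -/
class EnoughProjectives : Prop where
  exists_conflation : ∀ C : 𝒜, ∃ (A P : 𝒜) (x : A ⟶ P) (y : P ⟶ C),
    T.projIn ⊤ P ∧ T.Conflation x y

/-- Enough injectives (`injIn ⊤` being the injective objects of `𝒜`). -/
class EnoughInjectives : Prop where
  exists_conflation : ∀ A : 𝒜, ∃ (C I : 𝒜) (x : A ⟶ I) (y : I ⟶ C),
    T.injIn ⊤ I ∧ T.Conflation x y

/-- A chosen cosyzygy `Σ A`, the third term of a conflation `A ⟶ I ⟶ Σ A` with `I` injective. -/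
noncomputable def cosyzygy [T.EnoughInjectives] (A : 𝒜) : 𝒜 :=
  (EnoughInjectives.exists_conflation (T := T) A).choose

/-- The iterated cosyzygy `Σⁱ A`. -/
noncomputable def cosyzygyIter [T.EnoughInjectives] : ℕ → 𝒜 → 𝒜
  | 0, A => A
  | i + 1, A => T.cosyzygy (cosyzygyIter i A)

/-- The higher extension group `𝔼ⁱ⁺¹(X, Y) = 𝔼(X, Σⁱ Y)`, for `i ≥ 0`. -/
abbrev HigherExt [T.EnoughInjectives] (i : ℕ) (X Y : 𝒜) : Type w :=
  T.Ext X (T.cosyzygyIter i Y)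

/-- `ω^⊥ = {Y | 𝔼ⁱ(X, Y) = 0 for all i ≥ 1 and X ∈ ω}`. -/
def rightPerp [T.EnoughInjectives] (ω : ObjectProperty 𝒜) : ObjectProperty 𝒜 := fun Y =>
  ∀ X : 𝒜, ω X → ∀ (i : ℕ) (δ : T.HigherExt i X Y), δ = 0

/-- `^⊥ω = {Y | 𝔼ⁱ(Y, X) = 0 for all i ≥ 1 and X ∈ ω}`. -/
def leftPerp [T.EnoughInjectives] (ω : ObjectProperty 𝒜) : ObjectProperty 𝒜 := fun Y =>
  ∀ X : 𝒜, ω X → ∀ (i : ℕ) (δ : T.HigherExt i Y X), δ = 0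

/-- `ω` is self-orthogonal. -/
def SelfOrthogonal [T.EnoughInjectives] (ω : ObjectProperty 𝒜) : Prop := ω ≤ T.rightPerp ω

/-- The subcategory `_ω𝒳`: objects `A = K₀` for which there are `𝔼`-triangles
`K (n+1) ⟶ W n ⟶ K n ⇢`, `n ≥ 0`, with `W n ∈ ω` and `K n ∈ ω^⊥`. -/
def properResolved [T.EnoughInjectives] (ω : ObjectProperty 𝒜) : ObjectProperty 𝒜 := fun A =>
  ∃ (K W : ℕ → 𝒜) (g : ∀ n, K (n + 1) ⟶ W n) (f : ∀ n, W n ⟶ K n),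
    K 0 = A ∧ (∀ n, T.Conflation (g n) (f n)) ∧ (∀ n, ω (W n)) ∧ (∀ n, T.rightPerp ω (K n))

/-- `ℐ` is a relative injective cogenerator of `𝒴`. -/
structure IsRelInjCogenerator [T.EnoughInjectives] (ℐ 𝒴 : ObjectProperty 𝒜) : Prop where
  isSubcategory : IsSubcategory ℐ
  le : ℐ ≤ 𝒴 ⊓ T.rightPerp 𝒴
  exists_conflation : ∀ Y : 𝒜, 𝒴 Y → ∃ (I Y' : 𝒜) (x : Y ⟶ I) (y : I ⟶ Y'),
    ℐ I ∧ 𝒴 Y' ∧ T.Conflation x y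

/-- `ℬ` is a relative resolving subcategory of `𝒴`; extensions and cocones of deflations are
taken in `𝒴`, i.e. for `𝔼`-triangles with all three terms in `𝒴`. -/
structure IsRelResolving (ℬ 𝒴 : ObjectProperty 𝒜) : Prop where
  isSubcategory : IsSubcategory ℬ
  le : ℬ ≤ 𝒴
  ext : ∀ {A B C : 𝒜} (x : A ⟶ B) (y : B ⟶ C), T.Conflation x y → 𝒴 B → ℬ A → ℬ C → ℬ B
  cocone : ∀ {A B C : 𝒜} (x : A ⟶ B) (y : B ⟶ C), T.Conflation x y → 𝒴 A → ℬ B → ℬ C → ℬ A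
  proj : T.projIn 𝒴 ≤ ℬ

/-- `𝒟` is a relative coresolving subcategory of `𝒴`. -/
structure IsRelCoresolving (𝒟 𝒴 : ObjectProperty 𝒜) : Prop where
  isSubcategory : IsSubcategory 𝒟
  le : 𝒟 ≤ 𝒴
  ext : ∀ {A B C : 𝒜} (x : A ⟶ B) (y : B ⟶ C), T.Conflation x y → 𝒴 B → 𝒟 A → 𝒟 C → 𝒟 B
  cone : ∀ {A B C : 𝒜} (x : A ⟶ B) (y : B ⟶ C), T.Conflation x y → 𝒴 C → 𝒟 A → 𝒟 B → 𝒟 C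
  inj : T.injIn 𝒴 ≤ 𝒟

/-- `g : W ⟶ C` is a right `ω`-approximation. -/
def IsRightApprox (ω : ObjectProperty 𝒜) {W C : 𝒜} (g : W ⟶ C) : Prop :=
  ω W ∧ ∀ (W' : 𝒜) (f : W' ⟶ C), ω W' → ∃ h : W' ⟶ W, h ≫ g = f

/-- `g : C ⟶ W` is a left `ω`-approximation. -/
def IsLeftApprox (ω : ObjectProperty 𝒜) {C W : 𝒜} (g : C ⟶ W) : Prop :=
  ω W ∧ ∀ (W' : 𝒜) (f : C ⟶ W'), ω W' → ∃ h : W ⟶ W', g ≫ h = f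

/-- `ω` is strongly contravariantly finite in `𝒴` (`𝔼`-triangles in `𝒴`). -/
def StronglyContravariantlyFinite (ω 𝒴 : ObjectProperty 𝒜) : Prop :=
  ∀ C : 𝒜, 𝒴 C → ∃ (K W : 𝒜) (x : K ⟶ W) (g : W ⟶ C),
    𝒴 K ∧ T.Conflation x g ∧ IsRightApprox ω g

/-- `ω` is strongly covariantly finite in `𝒴` (`𝔼`-triangles in `𝒴`). -/
def StronglyCovariantlyFinite (ω 𝒴 : ObjectProperty 𝒜) : Prop :=
  ∀ C : 𝒜, 𝒴 C → ∃ (W V : 𝒜) (g : C ⟶ W) (y : W ⟶ V),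
    𝒴 V ∧ T.Conflation g y ∧ IsLeftApprox ω g

end Extriangulated

end Extri

/-! Write 𝒳 for `properResolved 𝒞`. It is closed under extensions, cones and summands, its
projectives are exactly 𝒞 and its injectives exactly ℐ, and it has enough of both. The theorem says
that a complete hereditary cotorsion pair (ℬ, 𝒟) in 𝒳 is determined by either half.

Given 𝒟, a left 𝒟-approximation of Y can be made left minimal by discarding summands
(Krull–Schmidt), and it stays an inflation by (WIC). Wakamatsu's lemma
(`extVanish_cone_of_leftMinimal`) kills the first extension group from its cone B to 𝒟; shifting
degrees along conflations D' → I → Y' with I in ℐ kills the higher ones. This gives a special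
conflation Y → D → B (`exists_specialLeft`). The argument for ℬ is dual, with 𝒞 replacing ℐ, but the
fibre must also be shown to lie in 𝒳.

If Y in 𝒳 is right orthogonal to ^⊥𝒟 ∩ 𝒳, its special conflation splits and Y is a summand of D;
with the dual this makes the two assignments inverse to each other. Salce's pushout and pullback
argument turns special conflations on one side into approximations on the other, so each assignment
lands in the right class. -/

namespace Extri

open scoped ZeroObject

/-! ### Formal calculus of extensions and their realizations -/

namespace PreExtriangulated

variable {𝒜 : Type u} [Category.{v} 𝒜] [Preadditive 𝒜] {T : PreExtriangulated.{w} 𝒜}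

@[simp] lemma push_id {A C : 𝒜} (δ : T.Ext C A) : push (𝟙 A) δ = δ := by
  simp [push]

@[simp] lemma pull_id {A C : 𝒜} (δ : T.Ext C A) : pull (𝟙 C) δ = δ := by
  simp [pull]

lemma push_comp {A A' A'' C : 𝒜} (a : A ⟶ A') (a' : A' ⟶ A'') (δ : T.Ext C A) :
    push (a ≫ a') δ = push a' (push a δ) := by
  simp [push]

lemma pull_comp {A C C' C'' : 𝒜} (c' : C'' ⟶ C') (c : C' ⟶ C) (δ : T.Ext C A) :
    pull (c' ≫ c) δ = pull c' (pull c δ) := by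
  simp [pull]

@[simp] lemma push_add {A A' C : 𝒜} (a : A ⟶ A') (δ δ' : T.Ext C A) :
    push a (δ + δ') = push a δ + push a δ' := map_add _ _ _

@[simp] lemma pull_add {A C C' : 𝒜} (c : C' ⟶ C) (δ δ' : T.Ext C A) :
    pull c (δ + δ') = pull c δ + pull c δ' := map_add _ _ _

@[simp] lemma push_zero {A A' C : 𝒜} (a : A ⟶ A') : push a (0 : T.Ext C A) = 0 := map_zero _

@[simp] lemma pull_zero {A C C' : 𝒜} (c : C' ⟶ C) : pull c (0 : T.Ext C A) = 0 := map_zero _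

lemma add_push {A A' C : 𝒜} (a a' : A ⟶ A') (δ : T.Ext C A) :
    push (a + a') δ = push a δ + push a' δ := by
  have := T.additive_right (op C)
  simp [push, Functor.map_add]

lemma add_pull {A C C' : 𝒜} (c c' : C' ⟶ C) (δ : T.Ext C A) :
    pull (c + c') δ = pull c δ + pull c' δ := by
  have := T.additive_left
  simp [pull, Functor.map_add]

@[simp] lemma zero_push {A A' C : 𝒜} (δ : T.Ext C A) : push (0 : A ⟶ A') δ = 0 := by
  simpa using add_push (0 : A ⟶ A') 0 δ

@[simp] lemma zero_pull {A C C' : 𝒜} (δ : T.Ext C A) : pull (0 : C' ⟶ C) δ = 0 := by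
  simpa using add_pull (0 : C' ⟶ C) 0 δ

lemma push_pull {A A' C C' : 𝒜} (a : A ⟶ A') (c : C' ⟶ C) (δ : T.Ext C A) :
    push a (pull c δ) = pull c (push a δ) := by
  simp [push, pull]

lemma exists_tri {A C : 𝒜} (δ : T.Ext C A) : ∃ (B : 𝒜) (x : A ⟶ B) (y : B ⟶ C), Tri x y δ := by
  obtain ⟨S, hS⟩ := Quotient.exists_rep (T.s δ)
  exact ⟨S.B, S.x, S.y, hS.symm⟩

lemma Tri.exists_iso {A B B' C : 𝒜} {δ : T.Ext C A} {x : A ⟶ B} {y : B ⟶ C} {x' : A ⟶ B'}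
    {y' : B' ⟶ C} (h : Tri x y δ) (h' : Tri x' y' δ) :
    ∃ b : B ≅ B', x ≫ b.hom = x' ∧ b.hom ≫ y' = y :=
  Quotient.exact (s := seqSetoid A C) (h.symm.trans h')

lemma Tri.of_iso {A B B' C : 𝒜} {δ : T.Ext C A} {x : A ⟶ B} {y : B ⟶ C} {x' : A ⟶ B'}
    {y' : B' ⟶ C} (h : Tri x y δ) (b : B ≅ B') (hx : x ≫ b.hom = x') (hy : b.hom ≫ y' = y) :
    Tri x' y' δ :=
  Eq.trans h (Quotient.sound (s := seqSetoid A C) ⟨b, hx, hy⟩)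

end PreExtriangulated

open PreExtriangulated

namespace Extriangulated

variable {𝒜 : Type u} [Category.{v} 𝒜] [Preadditive 𝒜] [HasFiniteBiproducts 𝒜]
  {T : Extriangulated.{w} 𝒜}

/-! ## Exact sequences -/

lemma tri_of_isZero_right {Z : 𝒜} (hZ : IsZero Z) (A : 𝒜) :
    Tri (𝟙 A) (0 : A ⟶ Z) (0 : T.Ext Z A) := by
  refine (T.realize_zero A Z).of_iso ⟨biprod.fst, biprod.inl, ?_, ?_⟩ (by simp)
    (hZ.eq_of_tgt _ _)
  · ext <;> simp
    exact hZ.eq_of_src _ _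
  · simp

lemma tri_of_isZero_left {Z : 𝒜} (hZ : IsZero Z) (A : 𝒜) :
    Tri (0 : Z ⟶ A) (𝟙 A) (0 : T.Ext A Z) := by
  refine (T.realize_zero Z A).of_iso ⟨biprod.snd, biprod.inr, ?_, ?_⟩ (hZ.eq_of_src _ _) (by simp)
  · ext <;> simp
    exact hZ.eq_of_tgt _ _
  · simp

variable {A B C : 𝒜} {x : A ⟶ B} {y : B ⟶ C} {δ : T.Ext C A}

lemma push_inflation (h : Tri x y δ) : push x δ = 0 := by
  obtain ⟨c, hc, -⟩ := T.et3 h (tri_of_isZero_right (isZero_zero 𝒜) B) x (𝟙 B) (by simp)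
  simpa using hc

lemma pull_deflation (h : Tri x y δ) : pull y δ = 0 := by
  obtain ⟨a, ha, -⟩ := T.et3_op (tri_of_isZero_left (isZero_zero 𝒜) B) h (𝟙 B) y (by simp)
  simpa using ha.symm

lemma exists_extension_of_push_eq_zero (h : Tri x y δ) {X : 𝒜} (a : A ⟶ X) (ha : push a δ = 0) :
    ∃ b : B ⟶ X, x ≫ b = a := by
  obtain ⟨b, hb, -⟩ := T.realization h (T.realize_zero X C) a (𝟙 C) (by simpa using ha)
  exact ⟨b ≫ biprod.fst, by simp [reassoc_of% hb]⟩

lemma exists_lift_of_pull_eq_zero (h : Tri x y δ) {X : 𝒜} (c : X ⟶ C) (hc : pull c δ = 0) :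
    ∃ b : X ⟶ B, b ≫ y = c := by
  obtain ⟨b, -, hb⟩ := T.realization (T.realize_zero A X) h (𝟙 A) c (by simpa using hc.symm)
  exact ⟨biprod.inr ≫ b, by simp [← hb]⟩

lemma exists_lift_of_comp_eq_zero (h : Tri x y δ) {X : 𝒜} (b : X ⟶ B) (hb : b ≫ y = 0) :
    ∃ a : X ⟶ A, a ≫ x = b := by
  obtain ⟨a, -, ha⟩ := T.et3_op (tri_of_isZero_right (isZero_zero 𝒜) X) h b 0 (by simp [hb])
  exact ⟨a, by simpa using ha.symm⟩

lemma exists_desc_of_comp_eq_zero (h : Tri x y δ) {X : 𝒜} (b : B ⟶ X) (hb : x ≫ b = 0) :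
    ∃ c : C ⟶ X, y ≫ c = b := by
  obtain ⟨c, -, hc⟩ := T.et3 h (tri_of_isZero_left (isZero_zero 𝒜) X) 0 b (by simp [hb])
  exact ⟨c, by simpa using hc⟩

lemma comp_eq_zero (h : Tri x y δ) : x ≫ y = 0 := by
  obtain ⟨b, hb, hb'⟩ := T.realization h (tri_of_isZero_left (isZero_zero 𝒜) C) 0 (𝟙 C)
    (by simp)
  have : b = y := by simpa using hb'.symm
  simpa [this] using hb

/-- Since `x` kills `ε`, it extends over the middle term of `ε`; (ET3) completes this extension to a
morphism of triangles, whose last component is the required `c`. -/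
lemma exists_eq_pull (h : Tri x y δ) {X : 𝒜} (ε : T.Ext X A) (hε : push x ε = 0) :
    ∃ c : X ⟶ C, pull c δ = ε := by
  obtain ⟨M, i, p, hM⟩ := exists_tri ε
  obtain ⟨m, hm⟩ := exists_extension_of_push_eq_zero hM x hε
  obtain ⟨c, hc, -⟩ := T.et3 hM h (𝟙 A) m (by simp [hm])
  exact ⟨c, by simpa using hc.symm⟩

lemma exists_eq_push (h : Tri x y δ) {X : 𝒜} (ε : T.Ext C X) (hε : pull y ε = 0) :
    ∃ a : A ⟶ X, push a δ = ε := by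
  obtain ⟨M, i, p, hM⟩ := exists_tri ε
  obtain ⟨m, hm⟩ := exists_lift_of_pull_eq_zero hM y hε
  obtain ⟨a, ha, -⟩ := T.et3_op h hM m (𝟙 C) (by simp [hm])
  exact ⟨a, by simpa using ha⟩

lemma exists_retraction {x : A ⟶ B} {y : B ⟶ C} (h : Tri x y (0 : T.Ext C A)) :
    ∃ r : B ⟶ A, x ≫ r = 𝟙 A :=
  exists_extension_of_push_eq_zero h _ (by simp)

lemma exists_section {x : A ⟶ B} {y : B ⟶ C} (h : Tri x y (0 : T.Ext C A)) :
    ∃ s : C ⟶ B, s ≫ y = 𝟙 C :=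
  exists_lift_of_pull_eq_zero h _ (by simp)

/-- (ET4) for `x` and a realization of `ε` produces a triangle over `X` realizing `push y ε`. As
that vanishes, the triangle has a section, along which the extension `δ''` given by (ET4) is pulled
back. -/
lemma exists_eq_push_inflation (h : Tri x y δ) {X : 𝒜} (ε : T.Ext X B) (hε : push y ε = 0) :
    ∃ ε' : T.Ext X A, push x ε' = ε := by
  obtain ⟨M, i, p, hM⟩ := exists_tri ε
  obtain ⟨G, h', d, e, δ'', -, -, -, hde, -, he⟩ := T.et4 h hM
  rw [hε] at hde
  obtain ⟨s, hs⟩ := exists_section hde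
  exact ⟨pull s δ'', by rw [push_pull, he, ← pull_comp, hs, pull_id]⟩

lemma exists_eq_pull_deflation (h : Tri x y δ) {X : 𝒜} (ε : T.Ext B X) (hε : pull x ε = 0) :
    ∃ ε' : T.Ext C X, pull y ε' = ε := by
  obtain ⟨M, i, p, hM⟩ := exists_tri ε
  obtain ⟨G, h', d, e, δ'', -, -, -, hde, -, he⟩ := T.et4_op hM h
  rw [hε] at hde
  obtain ⟨r, hr⟩ := exists_retraction hde
  exact ⟨push r δ'', by rw [← push_pull, ← he, ← push_comp, hr, push_id]⟩

lemma eq_zero_of_retraction (h : Tri x y δ) {r : B ⟶ A} (hr : x ≫ r = 𝟙 A) : δ = 0 := by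
  rw [← push_id δ, ← hr, push_comp, push_inflation h, push_zero]

lemma eq_zero_of_section (h : Tri x y δ) {s : C ⟶ B} (hs : s ≫ y = 𝟙 C) : δ = 0 := by
  rw [← pull_id δ, ← hs, pull_comp, pull_deflation h, pull_zero]

lemma nonempty_iso_biprod_of_tri_zero {x : A ⟶ B} {y : B ⟶ C} (h : Tri x y (0 : T.Ext C A)) :
    Nonempty (B ≅ A ⊞ C) :=
  let ⟨b, _⟩ := h.exists_iso (T.realize_zero A C)
  ⟨b⟩

/-! ## Transport of triangles along isomorphisms -/

/-- Exactness yields a one-sided inverse of `b` up to an error that factors through an end term,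
where the given isomorphisms correct it. This is done on both sides. -/
lemma isIso_of_isIso {A' B' C' : 𝒜} {x' : A' ⟶ B'} {y' : B' ⟶ C'} {δ' : T.Ext C' A'}
    (h : Tri x y δ) (h' : Tri x' y' δ') (a : A ≅ A') (b : B ⟶ B') (c : C ≅ C')
    (hac : push a.hom δ = pull c.hom δ') (hx : x ≫ b = a.hom ≫ x') (hy : y ≫ c.hom = b ≫ y') :
    IsIso b := by
  have hδ : δ = push a.inv (pull c.hom δ') := by simp [← hac, ← push_comp]
  have hδ' : δ' = pull c.inv (push a.hom δ) := by simp [hac, ← pull_comp]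
  obtain ⟨l, hl⟩ := exists_lift_of_pull_eq_zero h (y' ≫ c.inv) (by
    rw [hδ, ← push_pull, ← pull_comp]
    simp [pull_deflation h'])
  obtain ⟨t, ht⟩ := exists_lift_of_comp_eq_zero h' (𝟙 B' - l ≫ b) (by
    simp [← hy, reassoc_of% hl])
  obtain ⟨m, hm⟩ := exists_extension_of_push_eq_zero h' (a.inv ≫ x) (by
    rw [hδ', push_pull, ← push_comp]
    simp [push_inflation h])
  obtain ⟨q, hq⟩ := exists_desc_of_comp_eq_zero h (𝟙 B - b ≫ m) (by
    simp [reassoc_of% hx, hm])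
  have h1 : (l + t ≫ a.inv ≫ x) ≫ b = 𝟙 B' := by
    simp [hx, ht]
  have h2 : b ≫ (m + y' ≫ c.inv ≫ q) = 𝟙 B := by
    simp [← reassoc_of% hy, hq]
  have h3 : m + y' ≫ c.inv ≫ q = l + t ≫ a.inv ≫ x := by
    rw [← Category.id_comp (m + _), ← h1, Category.assoc, h2, Category.comp_id]
  exact ⟨_, h2, by rw [h3, h1]⟩

/-- Equivalence of sequences fixes the end terms, so the new sequence is compared with a realization
of the transported extension. -/
lemma tri_of_iso {A' B' C' : 𝒜} {x' : A' ⟶ B'} {y' : B' ⟶ C'} (h : Tri x y δ)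
    (a : A ≅ A') (b : B ≅ B') (c : C ≅ C') (hx : x ≫ b.hom = a.hom ≫ x')
    (hy : y ≫ c.hom = b.hom ≫ y') : Tri x' y' (push a.hom (pull c.inv δ)) := by
  obtain ⟨M, i, p, hM⟩ := exists_tri (push a.hom (pull c.inv δ))
  have hac : push a.hom δ = pull c.hom (push a.hom (pull c.inv δ)) := by
    simp [← push_pull, ← pull_comp]
  obtain ⟨m, hm, hm'⟩ := T.realization h hM a.hom c.hom hac
  have := isIso_of_isIso h hM a m c hac hm hm'
  refine hM.of_iso ((asIso m).symm ≪≫ b) ?_ ?_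
  · simp [← cancel_epi a.hom, ← reassoc_of% hm, hx]
  · simp [← hy, hm']

lemma Conflation.of_iso {A' B' C' : 𝒜} {x' : A' ⟶ B'} {y' : B' ⟶ C'} (h : T.Conflation x y)
    (a : A ≅ A') (b : B ≅ B') (c : C ≅ C') (hx : x ≫ b.hom = a.hom ≫ x')
    (hy : y ≫ c.hom = b.hom ≫ y') : T.Conflation x' y' :=
  let ⟨_, hδ⟩ := h
  ⟨_, tri_of_iso hδ a b c hx hy⟩

lemma conflation_biprod (A C : 𝒜) :
    T.Conflation (biprod.inl : A ⟶ A ⊞ C) (biprod.snd : A ⊞ C ⟶ C) :=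
  ⟨0, T.realize_zero A C⟩

lemma conflation_biprod' (A C : 𝒜) :
    T.Conflation (biprod.inr : C ⟶ A ⊞ C) (biprod.fst : A ⊞ C ⟶ A) :=
  (conflation_biprod C A).of_iso (Iso.refl _) (biprod.braiding _ _) (Iso.refl _)
    (by ext <;> simp) (by simp)

lemma Conflation.biprod_map {A' B' C' : 𝒜} {x' : A' ⟶ B'} {y' : B' ⟶ C'}
    (h : T.Conflation x y) (h' : T.Conflation x' y') :
    T.Conflation (biprod.map x x') (biprod.map y y') :=
  let ⟨_, hδ⟩ := h
  let ⟨_, hδ'⟩ := h'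
  ⟨_, T.realize_dsum hδ hδ'⟩

/-! ## Pullbacks and pushouts of conflations -/

/-- By (ET4) the cone of `j ≫ m` realizes `push q δ`, so it is identified with `B₂`. -/
lemma exists_conflation_of_push_eq {A₁ A₂ B₂ C M A : 𝒜} {x₂ : A₂ ⟶ B₂} {y₂ : B₂ ⟶ C}
    {j : A₁ ⟶ A} {q : A ⟶ A₂} {m : A ⟶ M} {e : M ⟶ C} {δ : T.Ext C A}
    (hj : T.Conflation j q) (hm : Tri m e δ) (h₂ : Tri x₂ y₂ (push q δ)) :
    ∃ e₂ : M ⟶ B₂, T.Conflation (j ≫ m) e₂ := by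
  obtain ⟨ε, hj⟩ := hj
  obtain ⟨G, h', d, e', δ'', -, -, hG, hde, -, -⟩ := T.et4 hj hm
  obtain ⟨b, -⟩ := hde.exists_iso h₂
  exact ⟨h' ≫ b.hom, _, tri_of_iso hG (Iso.refl _) (Iso.refl _) b (by simp) (by simp)⟩

lemma exists_conflation_of_pull_eq {C₁ C₂ B₂ A M C : 𝒜} {x₂ : A ⟶ B₂} {y₂ : B₂ ⟶ C₂}
    {j : C₂ ⟶ C} {q : C ⟶ C₁} {m : A ⟶ M} {e : M ⟶ C} {δ : T.Ext C A}
    (hj : T.Conflation j q) (hm : Tri m e δ) (h₂ : Tri x₂ y₂ (pull j δ)) :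
    ∃ e₂ : B₂ ⟶ M, T.Conflation e₂ (e ≫ q) := by
  obtain ⟨ε, hj⟩ := hj
  obtain ⟨G, h', d, e', δ'', -, -, hG, hde, -, -⟩ := T.et4_op hm hj
  obtain ⟨b, -⟩ := hde.exists_iso h₂
  exact ⟨b.inv ≫ h', _, tri_of_iso hG b (Iso.refl _) (Iso.refl _) (by simp) (by simp)⟩

lemma exists_pullback {A₁ A₂ B₁ B₂ C : 𝒜} {x₁ : A₁ ⟶ B₁} {y₁ : B₁ ⟶ C} {x₂ : A₂ ⟶ B₂}
    {y₂ : B₂ ⟶ C} (h₁ : T.Conflation x₁ y₁) (h₂ : T.Conflation x₂ y₂) :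
    ∃ (M : 𝒜) (m₁ : A₁ ⟶ M) (e₂ : M ⟶ B₂) (m₂ : A₂ ⟶ M) (e₁ : M ⟶ B₁),
      T.Conflation m₁ e₂ ∧ T.Conflation m₂ e₁ := by
  obtain ⟨δ₁, h₁⟩ := h₁
  obtain ⟨δ₂, h₂⟩ := h₂
  -- M realizes the extension of C by A₁ ⊞ A₂ with components δ₁ and δ₂; dividing out one summand
  -- leaves a realization of the other component.
  obtain ⟨M, m, e, hM⟩ := exists_tri
    (push (biprod.inl : A₁ ⟶ A₁ ⊞ A₂) δ₁ + push (biprod.inr : A₂ ⟶ A₁ ⊞ A₂) δ₂)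
  obtain ⟨e₂, he₂⟩ := exists_conflation_of_push_eq (conflation_biprod A₁ A₂) hM
    (x₂ := x₂) (y₂ := y₂) (by simpa [← push_comp])
  obtain ⟨e₁, he₁⟩ := exists_conflation_of_push_eq (conflation_biprod' A₁ A₂) hM
    (x₂ := x₁) (y₂ := y₁) (by simpa [← push_comp])
  exact ⟨M, _, e₂, _, e₁, he₂, he₁⟩

lemma exists_pushout {A B₁ B₂ C₁ C₂ : 𝒜} {x₁ : A ⟶ B₁} {y₁ : B₁ ⟶ C₁} {x₂ : A ⟶ B₂}
    {y₂ : B₂ ⟶ C₂} (h₁ : T.Conflation x₁ y₁) (h₂ : T.Conflation x₂ y₂) :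
    ∃ (M : 𝒜) (m₁ : B₁ ⟶ M) (e₂ : M ⟶ C₂) (m₂ : B₂ ⟶ M) (e₁ : M ⟶ C₁),
      T.Conflation m₁ e₂ ∧ T.Conflation m₂ e₁ := by
  obtain ⟨δ₁, h₁⟩ := h₁
  obtain ⟨δ₂, h₂⟩ := h₂
  obtain ⟨M, m, e, hM⟩ := exists_tri
    (pull (biprod.fst : C₁ ⊞ C₂ ⟶ C₁) δ₁ + pull (biprod.snd : C₁ ⊞ C₂ ⟶ C₂) δ₂)
  obtain ⟨m₁, hm₁⟩ := exists_conflation_of_pull_eq (conflation_biprod C₁ C₂) hM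
    (x₂ := x₁) (y₂ := y₁) (by simpa [← pull_comp])
  obtain ⟨m₂, hm₂⟩ := exists_conflation_of_pull_eq (conflation_biprod' C₁ C₂) hM
    (x₂ := x₂) (y₂ := y₂) (by simpa [← pull_comp])
  exact ⟨M, m₁, _, m₂, _, hm₁, hm₂⟩

lemma Conflation.exists_fibre_comp {A B C D F : 𝒜} {f' : D ⟶ A} {f : A ⟶ B} {g' : F ⟶ B}
    {g : B ⟶ C} (h : T.Conflation f' f) (h' : T.Conflation g' g) :
    ∃ (G : 𝒜) (i : G ⟶ A) (d : D ⟶ G) (e : G ⟶ F),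
      T.Conflation i (f ≫ g) ∧ T.Conflation d e := by
  obtain ⟨δ, h⟩ := h
  obtain ⟨δ', h'⟩ := h'
  obtain ⟨G, i, d, e, δ'', -, -, hi, hde, -⟩ := T.et4_op h h'
  exact ⟨G, i, d, e, ⟨_, hi⟩, ⟨_, hde⟩⟩

end Extriangulated

lemma IsSubcategory.summand_right {𝒜 : Type u} [Category.{v} 𝒜] [Preadditive 𝒜]
    [HasFiniteBiproducts 𝒜] {P : ObjectProperty 𝒜} (hP : IsSubcategory P) {X Y : 𝒜}
    (h : P (X ⊞ Y)) : P Y :=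
  hP.summand (hP.iso (biprod.braiding X Y) h)

lemma IsSubcategory.inf {𝒜 : Type u} [Category.{v} 𝒜] [Preadditive 𝒜]
    [HasFiniteBiproducts 𝒜] {P Q : ObjectProperty 𝒜} (hP : IsSubcategory P)
    (hQ : IsSubcategory Q) : IsSubcategory (P ⊓ Q) where
  zero Z hZ := ⟨hP.zero Z hZ, hQ.zero Z hZ⟩
  iso e h := ⟨hP.iso e h.1, hQ.iso e h.2⟩
  sum h h' := ⟨hP.sum h.1 h'.1, hQ.sum h.2 h'.2⟩
  summand h := ⟨hP.summand h.1, hQ.summand h.2⟩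

namespace Extriangulated

variable {𝒜 : Type u} [Category.{v} 𝒜] [Preadditive 𝒜] [HasFiniteBiproducts 𝒜]
  {T : Extriangulated.{w} 𝒜}

/-! ## Vanishing of extension groups -/

variable (T) in
/-- `𝔼(X, Y) = 0`. -/
def ExtVanish (X Y : 𝒜) : Prop := ∀ δ : T.Ext X Y, δ = 0

lemma ExtVanish.of_retract_right {X Y Y' : 𝒜} (h : T.ExtVanish X Y) {i : Y' ⟶ Y} {r : Y ⟶ Y'}
    (hr : i ≫ r = 𝟙 Y') : T.ExtVanish X Y' := fun δ => by
  rw [← push_id δ, ← hr, push_comp, h (push i δ), push_zero]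

lemma ExtVanish.of_retract_left {X X' Y : 𝒜} (h : T.ExtVanish X Y) {i : X' ⟶ X} {r : X ⟶ X'}
    (hr : i ≫ r = 𝟙 X') : T.ExtVanish X' Y := fun δ => by
  rw [← pull_id δ, ← hr, pull_comp, h (pull r δ), pull_zero]

lemma extVanish_of_isZero_left {Z : 𝒜} (hZ : IsZero Z) (Y : 𝒜) : T.ExtVanish Z Y := fun δ => by
  rw [← pull_id δ, hZ.eq_of_src (𝟙 Z) 0, zero_pull]

lemma extVanish_of_isZero_right {Z : 𝒜} (hZ : IsZero Z) (X : 𝒜) : T.ExtVanish X Z := fun δ => by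
  rw [← push_id δ, hZ.eq_of_src (𝟙 Z) 0, zero_push]

lemma ExtVanish.exists_lift {X A B C : 𝒜} (h : T.ExtVanish X A) {x : A ⟶ B} {y : B ⟶ C}
    (hxy : T.Conflation x y) (c : X ⟶ C) : ∃ b : X ⟶ B, b ≫ y = c :=
  let ⟨_, hδ⟩ := hxy
  exists_lift_of_pull_eq_zero hδ c (h _)

lemma ExtVanish.exists_desc {X A B C : 𝒜} (h : T.ExtVanish C X) {x : A ⟶ B} {y : B ⟶ C}
    (hxy : T.Conflation x y) (a : A ⟶ X) : ∃ b : B ⟶ X, x ≫ b = a :=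
  let ⟨_, hδ⟩ := hxy
  exists_extension_of_push_eq_zero hδ a (h _)

lemma ExtVanish.nonempty_iso {A B C : 𝒜} (h : T.ExtVanish C A) {x : A ⟶ B} {y : B ⟶ C}
    (hxy : T.Conflation x y) : Nonempty (B ≅ A ⊞ C) := by
  obtain ⟨δ, hδ⟩ := hxy
  obtain rfl := h δ
  exact nonempty_iso_biprod_of_tri_zero hδ

lemma nonempty_iso_of_section {A B C : 𝒜} {x : A ⟶ B} {y : B ⟶ C} (hxy : T.Conflation x y)
    {s : C ⟶ B} (hs : s ≫ y = 𝟙 C) : Nonempty (B ≅ A ⊞ C) := by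
  obtain ⟨δ, hδ⟩ := hxy
  obtain rfl := eq_zero_of_section hδ hs
  exact nonempty_iso_biprod_of_tri_zero hδ

lemma nonempty_iso_of_retraction {A B C : 𝒜} {x : A ⟶ B} {y : B ⟶ C} (hxy : T.Conflation x y)
    {r : B ⟶ A} (hr : x ≫ r = 𝟙 A) : Nonempty (B ≅ A ⊞ C) := by
  obtain ⟨δ, hδ⟩ := hxy
  obtain rfl := eq_zero_of_retraction hδ hr
  exact nonempty_iso_biprod_of_tri_zero hδ

lemma extVanish_of_injIn {I : 𝒜} (hI : T.injIn ⊤ I) (X : 𝒜) : T.ExtVanish X I := fun δ => by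
  obtain ⟨M, i, p, hM⟩ := exists_tri δ
  obtain ⟨r, hr⟩ := hI.2 i p trivial trivial trivial ⟨δ, hM⟩ (𝟙 I)
  exact eq_zero_of_retraction hM hr

lemma extVanish_of_projIn {P : 𝒜} (hP : T.projIn ⊤ P) (Y : 𝒜) : T.ExtVanish P Y := fun δ => by
  obtain ⟨M, i, p, hM⟩ := exists_tri δ
  obtain ⟨s, hs⟩ := hP.2 i p trivial trivial trivial ⟨δ, hM⟩ (𝟙 P)
  exact eq_zero_of_section hM hs

lemma ExtVanish.middle_right {X A B C : 𝒜} {x : A ⟶ B} {y : B ⟶ C} (h : T.Conflation x y)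
    (hA : T.ExtVanish X A) (hC : T.ExtVanish X C) : T.ExtVanish X B := fun ε => by
  obtain ⟨δ, h⟩ := h
  obtain ⟨ε', rfl⟩ := exists_eq_push_inflation h ε (hC _)
  rw [hA ε', push_zero]

lemma ExtVanish.middle_left {A B C Y : 𝒜} {x : A ⟶ B} {y : B ⟶ C} (h : T.Conflation x y)
    (hA : T.ExtVanish A Y) (hC : T.ExtVanish C Y) : T.ExtVanish B Y := fun ε => by
  obtain ⟨δ, h⟩ := h
  obtain ⟨ε', rfl⟩ := exists_eq_pull_deflation h ε (hA _)
  rw [hC ε', pull_zero]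

/-- Vanishing along a syzygy `K ⟶ P ⟶ X` of the first variable. -/
lemma ExtVanish.cone_right {X K P A B C : 𝒜} {k : K ⟶ P} {p : P ⟶ X} (hp : T.Conflation k p)
    (hP : T.ExtVanish P C) {x : A ⟶ B} {y : B ⟶ C} (h : T.Conflation x y)
    (hB : T.ExtVanish X B) (hA : T.ExtVanish K A) : T.ExtVanish X C := fun ε => by
  obtain ⟨δ, hp⟩ := hp
  obtain ⟨c, rfl⟩ := exists_eq_push hp ε (hP _)
  obtain ⟨d, rfl⟩ := hA.exists_lift h c
  rw [push_comp, hB (push d δ), push_zero]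

/-- Dimension shifting by hand, replacing a long exact sequence: `ε` comes from a map K → C, which
extends over P and then lifts to B, and pulling `δ` back along a map that factors through `y` gives
zero. -/
lemma ExtVanish.fibre_right {X K P A B C : 𝒜} {k : K ⟶ P} {p : P ⟶ X} (hp : T.Conflation k p)
    (hP : T.ExtVanish P A) {x : A ⟶ B} {y : B ⟶ C} (h : T.Conflation x y)
    (hC : T.ExtVanish X C) (hB : T.ExtVanish K B) : T.ExtVanish K A := fun ε => by
  obtain ⟨δ, hδ⟩ := h
  obtain ⟨c, rfl⟩ := exists_eq_pull hδ ε (hB _)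
  obtain ⟨c', rfl⟩ := hC.exists_desc hp c
  obtain ⟨d, rfl⟩ := hP.exists_lift ⟨δ, hδ⟩ c'
  rw [pull_comp, pull_comp, pull_deflation hδ, pull_zero, pull_zero]

/-- Vanishing along a cosyzygy `Y ⟶ I ⟶ S` of the second variable. -/
lemma ExtVanish.fibre_left {Y I S A B C : 𝒜} {i : Y ⟶ I} {q : I ⟶ S} (hi : T.Conflation i q)
    (hI : T.ExtVanish A I) {x : A ⟶ B} {y : B ⟶ C} (h : T.Conflation x y)
    (hB : T.ExtVanish B Y) (hC : T.ExtVanish C S) : T.ExtVanish A Y := fun ε => by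
  obtain ⟨δ, hi⟩ := hi
  obtain ⟨c, rfl⟩ := exists_eq_pull hi ε (hI _)
  obtain ⟨d, rfl⟩ := hC.exists_desc h c
  rw [pull_comp, hB (pull d δ), pull_zero]

lemma ExtVanish.cone_left {Y I S A B C : 𝒜} {i : Y ⟶ I} {q : I ⟶ S} (hi : T.Conflation i q)
    (hI : T.ExtVanish C I) {x : A ⟶ B} {y : B ⟶ C} (h : T.Conflation x y)
    (hA : T.ExtVanish A Y) (hB : T.ExtVanish B S) : T.ExtVanish C S := fun ε => by
  obtain ⟨δ, hδ⟩ := h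
  obtain ⟨c, rfl⟩ := exists_eq_push hδ ε (hB _)
  obtain ⟨c', rfl⟩ := hA.exists_lift hi c
  obtain ⟨d, rfl⟩ := hI.exists_desc ⟨δ, hδ⟩ c'
  rw [push_comp, push_comp, push_inflation hδ, push_zero, push_zero]

/-! ## Higher extension groups -/

section EnoughProjectives

variable [T.EnoughProjectives]

variable (T) in
/-- A chosen syzygy `Ω X`. -/
noncomputable def syzygy (X : 𝒜) : 𝒜 :=
  (EnoughProjectives.exists_conflation (T := T) X).choose

variable (T) in
lemma exists_conflation_syzygy (X : 𝒜) : ∃ (P : 𝒜) (k : T.syzygy X ⟶ P) (p : P ⟶ X),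
    T.projIn ⊤ P ∧ T.Conflation k p :=
  (EnoughProjectives.exists_conflation (T := T) X).choose_spec

variable (T) in
/-- The iterated syzygy `Ωⁱ X`. -/
noncomputable def syzygyIter : ℕ → 𝒜 → 𝒜
  | 0, X => X
  | i + 1, X => syzygyIter i (T.syzygy X)

lemma syzygyIter_succ' (i : ℕ) (X : 𝒜) :
    T.syzygyIter (i + 1) X = T.syzygy (T.syzygyIter i X) := by
  induction i generalizing X with
  | zero => rfl
  | succ i ih => exact ih _

end EnoughProjectives

section EnoughInjectives

variable [T.EnoughInjectives]

variable (T) in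
lemma exists_conflation_cosyzygy (Y : 𝒜) : ∃ (I : 𝒜) (i : Y ⟶ I) (q : I ⟶ T.cosyzygy Y),
    T.injIn ⊤ I ∧ T.Conflation i q :=
  (EnoughInjectives.exists_conflation (T := T) Y).choose_spec

variable (T) in
/-- `𝔼ⁱ⁺¹(X, Y) = 0`. -/
def HigherExtVanish (i : ℕ) (X Y : 𝒜) : Prop := ∀ δ : T.HigherExt i X Y, δ = 0

lemma HigherExtVanish.middle_left {i : ℕ} {A B C Y : 𝒜} {x : A ⟶ B} {y : B ⟶ C}
    (h : T.Conflation x y) (hA : T.HigherExtVanish i A Y) (hC : T.HigherExtVanish i C Y) :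
    T.HigherExtVanish i B Y :=
  ExtVanish.middle_left h hA hC

lemma HigherExtVanish.fibre_left {i : ℕ} {A B C Y : 𝒜} {x : A ⟶ B} {y : B ⟶ C}
    (h : T.Conflation x y) (hB : T.HigherExtVanish i B Y) (hC : T.HigherExtVanish (i + 1) C Y) :
    T.HigherExtVanish i A Y := by
  obtain ⟨I, j, q, hI, hj⟩ := T.exists_conflation_cosyzygy (T.cosyzygyIter i Y)
  exact ExtVanish.fibre_left hj (extVanish_of_injIn hI _) h hB hC

lemma HigherExtVanish.cone_left {i : ℕ} {A B C Y : 𝒜} {x : A ⟶ B} {y : B ⟶ C}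
    (h : T.Conflation x y) (hA : T.HigherExtVanish i A Y) (hB : T.HigherExtVanish (i + 1) B Y) :
    T.HigherExtVanish (i + 1) C Y := by
  obtain ⟨I, j, q, hI, hj⟩ := T.exists_conflation_cosyzygy (T.cosyzygyIter i Y)
  exact ExtVanish.cone_left hj (extVanish_of_injIn hI _) h hA hB

lemma leftPerp_isSubcategory (ω : ObjectProperty 𝒜) : IsSubcategory (T.leftPerp ω) where
  zero _ hZ _ _ _ := extVanish_of_isZero_left hZ _
  iso e h W hW i := ExtVanish.of_retract_left (h W hW i) e.inv_hom_id
  sum h h' W hW i :=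
    HigherExtVanish.middle_left (conflation_biprod _ _) (h W hW i) (h' W hW i)
  summand h W hW i := ExtVanish.of_retract_left (h W hW i) biprod.inl_fst

lemma leftPerp_antitone {ω ω' : ObjectProperty 𝒜} (h : ω ≤ ω') : T.leftPerp ω' ≤ T.leftPerp ω :=
  fun _ hY W hW => hY W (h _ hW)

lemma le_leftPerp_rightPerp (ω : ObjectProperty 𝒜) : ω ≤ T.leftPerp (T.rightPerp ω) :=
  fun X hX _ hY => hY X hX

section EnoughProjectives

variable [T.EnoughProjectives]

lemma extVanish_cosyzygy_iff {X Y : 𝒜} :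
    T.ExtVanish X (T.cosyzygy Y) ↔ T.ExtVanish (T.syzygy X) Y := by
  obtain ⟨I, j, q, hI, hj⟩ := T.exists_conflation_cosyzygy Y
  obtain ⟨P, k, p, hP, hp⟩ := T.exists_conflation_syzygy X
  exact ⟨fun h => ExtVanish.fibre_left hj (extVanish_of_injIn hI _) hp
      (extVanish_of_projIn hP _) h,
    fun h => ExtVanish.cone_right hp (extVanish_of_projIn hP _) hj (extVanish_of_injIn hI _) h⟩

/-- Chosen cosyzygies are not functorial in the second variable. Moving the shift to syzygies of the
first variable makes closure properties in the second one accessible. -/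
lemma higherExtVanish_iff_syzygyIter {i : ℕ} {X Y : 𝒜} :
    T.HigherExtVanish i X Y ↔ T.ExtVanish (T.syzygyIter i X) Y := by
  induction i generalizing X with
  | zero => exact Iff.rfl
  | succ i ih => exact extVanish_cosyzygy_iff.trans ih

lemma HigherExtVanish.middle_right {i : ℕ} {X A B C : 𝒜} {x : A ⟶ B} {y : B ⟶ C}
    (h : T.Conflation x y) (hA : T.HigherExtVanish i X A) (hC : T.HigherExtVanish i X C) :
    T.HigherExtVanish i X B := by
  rw [higherExtVanish_iff_syzygyIter] at *
  exact ExtVanish.middle_right h hA hC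

lemma HigherExtVanish.cone_right {i : ℕ} {X A B C : 𝒜} {x : A ⟶ B} {y : B ⟶ C}
    (h : T.Conflation x y) (hB : T.HigherExtVanish i X B) (hA : T.HigherExtVanish (i + 1) X A) :
    T.HigherExtVanish i X C := by
  rw [higherExtVanish_iff_syzygyIter] at *
  rw [syzygyIter_succ'] at hA
  obtain ⟨P, k, p, hP, hp⟩ := T.exists_conflation_syzygy (T.syzygyIter i X)
  exact ExtVanish.cone_right hp (extVanish_of_projIn hP _) h hB hA

lemma HigherExtVanish.fibre_right {i : ℕ} {X A B C : 𝒜} {x : A ⟶ B} {y : B ⟶ C}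
    (h : T.Conflation x y) (hC : T.HigherExtVanish i X C)
    (hB : T.HigherExtVanish (i + 1) X B) : T.HigherExtVanish (i + 1) X A := by
  rw [higherExtVanish_iff_syzygyIter] at *
  rw [syzygyIter_succ'] at *
  obtain ⟨P, k, p, hP, hp⟩ := T.exists_conflation_syzygy (T.syzygyIter i X)
  exact ExtVanish.fibre_right hp (extVanish_of_projIn hP _) h hC hB

lemma HigherExtVanish.of_retract_right {i : ℕ} {X Y Y' : 𝒜} (h : T.HigherExtVanish i X Y)
    {j : Y' ⟶ Y} {r : Y ⟶ Y'} (hr : j ≫ r = 𝟙 Y') : T.HigherExtVanish i X Y' := by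
  rw [higherExtVanish_iff_syzygyIter] at *
  exact h.of_retract_right hr

lemma rightPerp_isSubcategory (ω : ObjectProperty 𝒜) : IsSubcategory (T.rightPerp ω) where
  zero _ hZ _ _ _ := higherExtVanish_iff_syzygyIter.2 (extVanish_of_isZero_right hZ _)
  iso e h X hX i := HigherExtVanish.of_retract_right (h X hX i) e.inv_hom_id
  sum h h' X hX i :=
    HigherExtVanish.middle_right (conflation_biprod _ _) (h X hX i) (h' X hX i)
  summand h X hX i := HigherExtVanish.of_retract_right (h X hX i) biprod.inl_fst

lemma rightPerp_middle {ω : ObjectProperty 𝒜} {A B C : 𝒜} {x : A ⟶ B} {y : B ⟶ C}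
    (h : T.Conflation x y) (hA : T.rightPerp ω A) (hC : T.rightPerp ω C) : T.rightPerp ω B :=
  fun X hX i => HigherExtVanish.middle_right h (hA X hX i) (hC X hX i)

lemma rightPerp_cone {ω : ObjectProperty 𝒜} {A B C : 𝒜} {x : A ⟶ B} {y : B ⟶ C}
    (h : T.Conflation x y) (hA : T.rightPerp ω A) (hB : T.rightPerp ω B) : T.rightPerp ω C :=
  fun X hX i => HigherExtVanish.cone_right h (hB X hX i) (hA X hX (i + 1))

end EnoughProjectives

end EnoughInjectives

/-- A form of the horseshoe lemma. -/
lemma exists_conflation_horseshoe {A B C K₁ W₁ K₂ W₂ : 𝒜} {x : A ⟶ B} {y : B ⟶ C}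
    (h : T.Conflation x y) {k₁ : K₁ ⟶ W₁} {p₁ : W₁ ⟶ A} (h₁ : T.Conflation k₁ p₁)
    {k₂ : K₂ ⟶ W₂} {p₂ : W₂ ⟶ C} (h₂ : T.Conflation k₂ p₂) (hv : T.ExtVanish W₂ A) :
    ∃ (K : 𝒜) (a : K₁ ⟶ K) (b : K ⟶ K₂) (k : K ⟶ W₁ ⊞ W₂) (p : W₁ ⊞ W₂ ⟶ B),
      T.Conflation a b ∧ T.Conflation k p := by
  obtain ⟨M, m₁, e₂, m₂, e₁, hM₁, hM₂⟩ := exists_pullback h h₂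
  -- The pullback splits as A ⊞ W₂, so W₁ ⊞ W₂ → A ⊞ W₂ → B is a composite of deflations; (ET4)ᵒᵖ
  -- exhibits its fibre as an extension of K₂ by K₁.
  obtain ⟨e⟩ := hv.nonempty_iso hM₁
  have hM₃ : T.Conflation (m₂ ≫ e.hom) (e.inv ≫ e₁) :=
    hM₂.of_iso (Iso.refl _) e (Iso.refl _) (by simp) (by simp)
  have h0 : T.Conflation (0 : (0 : 𝒜) ⟶ W₂) (𝟙 W₂) := ⟨_, tri_of_isZero_left (isZero_zero 𝒜) W₂⟩
  have h₁' : T.Conflation (biprod.inl ≫ biprod.map k₁ (0 : (0 : 𝒜) ⟶ W₂)) (biprod.map p₁ (𝟙 W₂)) :=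
    (h₁.biprod_map h0).of_iso
      ⟨biprod.fst, biprod.inl, by ext; simp, by simp⟩
      (Iso.refl _) (Iso.refl _) (by ext <;> simp) (by simp)
  obtain ⟨K, i, d, e, hi, hd⟩ := h₁'.exists_fibre_comp hM₃
  exact ⟨K, d, e, i, _, hd, hi⟩

/-! ## The subcategory of properly resolved objects -/

section ProperResolved

variable [T.EnoughInjectives] {𝒞 : ObjectProperty 𝒜}

lemma properResolved_le_rightPerp : T.properResolved 𝒞 ≤ T.rightPerp 𝒞 := by
  rintro A ⟨K, W, g, f, rfl, -, -, hK⟩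
  exact hK 0

lemma exists_conflation_of_properResolved {A : 𝒜} (h : T.properResolved 𝒞 A) :
    ∃ (K W : 𝒜) (k : K ⟶ W) (p : W ⟶ A), T.properResolved 𝒞 K ∧ 𝒞 W ∧ T.Conflation k p := by
  obtain ⟨K, W, g, f, rfl, hgf, hW, hK⟩ := h
  exact ⟨K 1, W 0, g 0, f 0, ⟨fun n => K (n + 1), fun n => W (n + 1), fun n => g (n + 1),
    fun n => f (n + 1), rfl, fun n => hgf _, fun n => hW _, fun n => hK _⟩, hW 0, hgf 0⟩

/-- `_𝒞𝒳` is the largest subcategory of `𝒞^⊥` each of whose objects is a quotient of an object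
of `𝒞` by an object of the subcategory. -/
lemma le_properResolved {S : ObjectProperty 𝒜} (hS : S ≤ T.rightPerp 𝒞)
    (h : ∀ A, S A → ∃ (K W : 𝒜) (k : K ⟶ W) (p : W ⟶ A), S K ∧ 𝒞 W ∧ T.Conflation k p) :
    S ≤ T.properResolved 𝒞 := by
  intro A hA
  choose K W k p hK hW hkp using h
  let step : {X // S X} → {X // S X} := fun X => ⟨K X.1 X.2, hK X.1 X.2⟩
  let Q : ℕ → {X // S X} := fun n => Nat.rec ⟨A, hA⟩ (fun _ => step) n
  exact ⟨fun n => (Q n).1, fun n => W _ (Q n).2, fun n => k _ (Q n).2, fun n => p _ (Q n).2,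
    rfl, fun n => hkp _ (Q n).2, fun n => hW _ (Q n).2, fun n => hS _ (Q n).2⟩

lemma properResolved_of_conflation {K W A : 𝒜} {k : K ⟶ W} {p : W ⟶ A} (h : T.Conflation k p)
    (hK : T.properResolved 𝒞 K) (hW : 𝒞 W) (hA : T.rightPerp 𝒞 A) : T.properResolved 𝒞 A := by
  refine le_properResolved (S := fun X => T.properResolved 𝒞 X ∨ X = A) ?_ ?_ A (Or.inr rfl)
  · rintro X (hX | rfl)
    exacts [properResolved_le_rightPerp _ hX, hA]
  · rintro X (hX | rfl)
    · obtain ⟨K, W, k, p, hK, hW, hkp⟩ := exists_conflation_of_properResolved hX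
      exact ⟨K, W, k, p, Or.inl hK, hW, hkp⟩
    · exact ⟨K, W, k, p, Or.inl hK, hW, h⟩

lemma le_properResolved_self (h𝒞 : IsSubcategory 𝒞) (hself : T.SelfOrthogonal 𝒞) :
    𝒞 ≤ T.properResolved 𝒞 :=
  le_properResolved hself fun A hA => ⟨_, A, 0, 𝟙 A, h𝒞.zero _ (isZero_zero 𝒜), hA,
    _, tri_of_isZero_left (isZero_zero 𝒜) A⟩

lemma extVanish_of_properResolved {W A : 𝒜} (hW : 𝒞 W) (hA : T.properResolved 𝒞 A) :
    T.ExtVanish W A :=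
  properResolved_le_rightPerp _ hA W hW 0

lemma le_projIn (h𝒞 : IsSubcategory 𝒞) (hself : T.SelfOrthogonal 𝒞) :
    𝒞 ≤ T.projIn (T.properResolved 𝒞) := fun _ hP =>
  ⟨le_properResolved_self h𝒞 hself _ hP, fun _ _ hA _ _ h c =>
    (extVanish_of_properResolved hP hA).exists_lift h c⟩

lemma projIn_le (h𝒞 : IsSubcategory 𝒞) (hself : T.SelfOrthogonal 𝒞) :
    T.projIn (T.properResolved 𝒞) ≤ 𝒞 := fun P hP => by
  obtain ⟨K, W, k, p, hK, hW, hkp⟩ := exists_conflation_of_properResolved hP.1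
  obtain ⟨s, hs⟩ := hP.2 k p hK (le_properResolved_self h𝒞 hself _ hW) hP.1 hkp (𝟙 P)
  obtain ⟨e⟩ := nonempty_iso_of_section hkp hs
  exact h𝒞.summand_right (h𝒞.iso e hW)

variable [T.EnoughProjectives]

/-- Coinduction: the class of all extensions of objects of 𝒳 by objects of 𝒳 is again resolved by 𝒞
inside itself, by the horseshoe lemma. -/
lemma properResolved_middle (h𝒞 : IsSubcategory 𝒞) {A B C : 𝒜} {x : A ⟶ B} {y : B ⟶ C}
    (h : T.Conflation x y) (hA : T.properResolved 𝒞 A) (hC : T.properResolved 𝒞 C) :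
    T.properResolved 𝒞 B := by
  refine le_properResolved (S := fun B => ∃ (A C : 𝒜) (x : A ⟶ B) (y : B ⟶ C),
    T.properResolved 𝒞 A ∧ T.properResolved 𝒞 C ∧ T.Conflation x y) ?_ ?_ B
    ⟨A, C, x, y, hA, hC, h⟩
  · rintro B ⟨A, C, x, y, hA, hC, h⟩
    exact rightPerp_middle h (properResolved_le_rightPerp _ hA) (properResolved_le_rightPerp _ hC)
  · rintro B ⟨A, C, x, y, hA, hC, h⟩
    obtain ⟨K₁, W₁, k₁, p₁, hK₁, hW₁, h₁⟩ := exists_conflation_of_properResolved hA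
    obtain ⟨K₂, W₂, k₂, p₂, hK₂, hW₂, h₂⟩ := exists_conflation_of_properResolved hC
    obtain ⟨K, a, b, k, p, hab, hkp⟩ :=
      exists_conflation_horseshoe h h₁ h₂ (extVanish_of_properResolved hW₂ hA)
    exact ⟨K, _, k, p, ⟨K₁, K₂, a, b, hK₁, hK₂, hab⟩, h𝒞.sum hW₁ hW₂, hkp⟩

/-- The fibre of the composite W → B → C is an extension of A by K, hence lies in 𝒳. -/
lemma properResolved_cone (h𝒞 : IsSubcategory 𝒞) {A B C : 𝒜} {x : A ⟶ B} {y : B ⟶ C}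
    (h : T.Conflation x y) (hA : T.properResolved 𝒞 A) (hB : T.properResolved 𝒞 B) :
    T.properResolved 𝒞 C := by
  obtain ⟨K, W, k, p, hK, hW, hkp⟩ := exists_conflation_of_properResolved hB
  obtain ⟨G, i, d, e, hi, hd⟩ := hkp.exists_fibre_comp h
  exact properResolved_of_conflation hi (properResolved_middle h𝒞 hd hK hA) hW
    (rightPerp_cone h (properResolved_le_rightPerp _ hA) (properResolved_le_rightPerp _ hB))

/-- Coinduction on summands of objects of 𝒳. The fibre G of W → X ⊞ Y → X is not yet known to lie in
𝒳, but G ⊞ X is an extension of X ⊞ Y by K, so G is again a summand of an object of 𝒳. -/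
lemma properResolved_summand (h𝒞 : IsSubcategory 𝒞) {X Y : 𝒜} (h : T.properResolved 𝒞 (X ⊞ Y)) :
    T.properResolved 𝒞 X := by
  refine le_properResolved (S := fun X => ∃ Y, T.properResolved 𝒞 (X ⊞ Y)) ?_ ?_ X ⟨Y, h⟩
  · rintro X ⟨Y, h⟩
    exact (rightPerp_isSubcategory _).summand (properResolved_le_rightPerp _ h)
  · rintro X ⟨Y, h⟩
    obtain ⟨K, W, k, p, hK, hW, hkp⟩ := exists_conflation_of_properResolved h
    obtain ⟨G, i, d, e, hi, hd⟩ := hkp.exists_fibre_comp (conflation_biprod' X Y)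
    have h0 : T.Conflation (0 : (0 : 𝒜) ⟶ X) (𝟙 X) := ⟨_, tri_of_isZero_left (isZero_zero 𝒜) X⟩
    have hd' : T.Conflation (biprod.inl ≫ biprod.map d (0 : (0 : 𝒜) ⟶ X))
        (biprod.map e (𝟙 X) ≫ (biprod.braiding Y X).hom) :=
      (hd.biprod_map h0).of_iso
        ⟨biprod.fst, biprod.inl, by ext; simp, by simp⟩
        (Iso.refl _) (biprod.braiding Y X) (by ext <;> simp) (by simp)
    exact ⟨G, W, i, _, ⟨X, properResolved_middle h𝒞 hd' hK h⟩, hW, hi⟩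

lemma properResolved_isSubcategory (h𝒞 : IsSubcategory 𝒞) (hself : T.SelfOrthogonal 𝒞) :
    IsSubcategory (T.properResolved 𝒞) where
  zero Z hZ := le_properResolved_self h𝒞 hself _ (h𝒞.zero Z hZ)
  iso {X Y} e h := properResolved_cone h𝒞 (x := (0 : (0 : 𝒜) ⟶ X)) (y := e.hom)
    (Conflation.of_iso ⟨_, tri_of_isZero_left (isZero_zero 𝒜) X⟩ (Iso.refl _) (Iso.refl _) e
      (by simp) (by simp))
    (le_properResolved_self h𝒞 hself _ (h𝒞.zero _ (isZero_zero 𝒜))) h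
  sum {X Y} h h' := properResolved_middle h𝒞 (conflation_biprod X Y) h h'
  summand h := properResolved_summand h𝒞 h

/-- The pullback of B → C and W → C is an extension of B by K, hence in 𝒳; it splits as A ⊞ W
because A is in 𝒞^⊥. -/
lemma properResolved_fibre (h𝒞 : IsSubcategory 𝒞) (hself : T.SelfOrthogonal 𝒞) {A B C : 𝒜}
    {x : A ⟶ B} {y : B ⟶ C} (h : T.Conflation x y) (hA : T.rightPerp 𝒞 A)
    (hB : T.properResolved 𝒞 B) (hC : T.properResolved 𝒞 C) : T.properResolved 𝒞 A := by
  obtain ⟨K, W, k, p, hK, hW, hkp⟩ := exists_conflation_of_properResolved hC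
  obtain ⟨M, m₁, e₂, m₂, e₁, hM₁, hM₂⟩ := exists_pullback h hkp
  obtain ⟨e⟩ := ExtVanish.nonempty_iso (hA W hW 0) hM₁
  have hs := properResolved_isSubcategory h𝒞 hself
  exact hs.summand (hs.iso e (properResolved_middle h𝒞 hM₂ hK hB))

/-- `K` is in `𝒞^⊥` when `K ⟶ B ⟶ C` is a conflation which is exact on maps from `𝒞`. -/
lemma rightPerp_fibre {A B C : 𝒜} {x : A ⟶ B} {y : B ⟶ C} (h : T.Conflation x y)
    (hB : T.rightPerp 𝒞 B) (hC : T.rightPerp 𝒞 C)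
    (hy : ∀ W, 𝒞 W → ∀ c : W ⟶ C, ∃ b : W ⟶ B, b ≫ y = c) : T.rightPerp 𝒞 A := by
  rintro W hW (_ | i)
  · intro (ε : T.Ext W A)
    obtain ⟨δ, hδ⟩ := h
    obtain ⟨c, rfl⟩ := exists_eq_pull hδ ε (hB W hW 0 _)
    obtain ⟨b, rfl⟩ := hy W hW c
    rw [pull_comp, pull_deflation hδ, pull_zero]
    rfl
  · exact HigherExtVanish.fibre_right h (hC W hW i) (hB W hW (i + 1))

end ProperResolved

/-! ### Relative injectives coincide with the cogenerator -/

section RelInjCogenerator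

variable [T.EnoughInjectives] {ℐ 𝒴 : ObjectProperty 𝒜}

lemma IsRelInjCogenerator.le_injIn (h : T.IsRelInjCogenerator ℐ 𝒴) : ℐ ≤ T.injIn 𝒴 :=
  fun _ hI => ⟨(h.le _ hI).1, fun _ _ _ _ hC hxy a =>
    ExtVanish.exists_desc ((h.le _ hI).2 _ hC 0) hxy a⟩

lemma IsRelInjCogenerator.injIn_le (h : T.IsRelInjCogenerator ℐ 𝒴) : T.injIn 𝒴 ≤ ℐ :=
  fun J hJ => by
    obtain ⟨I, Y', x, y, hI, hY', hxy⟩ := h.exists_conflation J hJ.1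
    obtain ⟨r, hr⟩ := hJ.2 x y hJ.1 (h.le _ hI).1 hY' hxy (𝟙 J)
    obtain ⟨e⟩ := nonempty_iso_of_retraction hxy hr
    exact h.isSubcategory.summand (h.isSubcategory.iso e hI)

end RelInjCogenerator

end Extriangulated

section KrullSchmidt

variable {𝒜 : Type u} [Category.{v} 𝒜] [Preadditive 𝒜]

/-! ## Minimal morphisms in Krull-Schmidt categories -/

/-- If `a ≫ t` were a unit with inverse `u`, then `t ≫ u ≫ a` would be an idempotent of a local
ring: 1 makes `a` an isomorphism, 0 forces `a = 0`. -/
lemma isUnit_one_add_of_not_isIso {X Y : 𝒜} [IsLocalRing (End X)] [IsLocalRing (End Y)]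
    {a : X ⟶ Y} (ha : ¬ IsIso a) (t : Y ⟶ X) : IsUnit (1 + End.of (a ≫ t)) := by
  have hadd : IsUnit (-End.of (a ≫ t) + (1 + End.of (a ≫ t))) := by
    rw [neg_add_cancel_comm_assoc]
    exact isUnit_one
  refine (IsLocalRing.isUnit_or_isUnit_of_isUnit_add hadd).resolve_left fun h => ha ?_
  obtain ⟨⟨p, u, hu, hu'⟩, (hp : p = a ≫ t)⟩ := (IsUnit.neg_iff (End.of (a ≫ t))).1 h
  subst hp
  replace hu : u ≫ a ≫ t = 𝟙 X := hu
  replace hu' : (a ≫ t) ≫ u = 𝟙 X := hu'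
  rw [Category.assoc] at hu'
  let e : End Y := t ≫ u ≫ a
  have he : e * e = e := by
    change (t ≫ u ≫ a) ≫ (t ≫ u ≫ a) = t ≫ u ≫ a
    simp [reassoc_of% hu']
  have hadd' : IsUnit (e + (1 - e)) := by
    rw [add_sub_cancel]
    exact isUnit_one
  rcases IsLocalRing.isUnit_or_isUnit_of_isUnit_add hadd' with h1 | h1
  · have he1 : e = 1 := h1.mul_left_cancel (by rw [he, mul_one])
    exact ⟨t ≫ u, hu', by simpa using (show t ≫ u ≫ a = 𝟙 Y from he1)⟩
  · have he0 : e = 0 := h1.mul_left_cancel (by rw [sub_mul, he, one_mul, sub_self, mul_zero])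
    have he0' : t ≫ u ≫ a = 0 := he0
    have ha0 : a = 0 := by
      rw [← Category.id_comp a, ← hu']
      simp [he0']
    have : (1 : End X) = 0 := by
      change 𝟙 X = 0
      rw [← hu', ha0, zero_comp]
    exact absurd this one_ne_zero

lemma mem_jacobson_of_not_isIso {D X Y : 𝒜} [IsLocalRing (End X)] [IsLocalRing (End Y)]
    (p : D ⟶ X) {a : X ⟶ Y} (ha : ¬ IsIso a) (j : Y ⟶ D) :
    End.of (p ≫ a ≫ j) ∈ (⊥ : Ideal (End D)).jacobson := by
  rw [Ideal.mem_jacobson_iff]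
  intro (y : D ⟶ D)
  obtain ⟨⟨z, u, hu, hu'⟩, hz⟩ := isUnit_one_add_of_not_isIso ha (j ≫ y ≫ p)
  simp only at hz
  subst hz
  replace hu' : (𝟙 X + a ≫ j ≫ y ≫ p) ≫ u = 𝟙 X := by
    have := ‹u * _ = 1›
    exact this
  -- With v = a ≫ j ≫ y, this is the usual inverse of 1 + pv built from the inverse `u` of 1 + vp.
  refine ⟨𝟙 D - p ≫ u ≫ a ≫ j ≫ y, ?_⟩
  rw [Submodule.mem_bot]
  change (p ≫ a ≫ j) ≫ y ≫ (𝟙 D - p ≫ u ≫ a ≫ j ≫ y) + (𝟙 D - p ≫ u ≫ a ≫ j ≫ y) - 𝟙 D = 0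
  have h : p ≫ ((𝟙 X + a ≫ j ≫ y ≫ p) ≫ u) ≫ a ≫ j ≫ y = p ≫ a ≫ j ≫ y := by
    rw [hu', Category.id_comp]
  simp only [Preadditive.add_comp, Preadditive.comp_add, Category.id_comp, Category.assoc] at h
  simp only [Preadditive.comp_sub, Category.comp_id, Category.assoc]
  rw [← h]
  abel

lemma isIso_of_one_sub_mem_jacobson {D : 𝒜} (g : End D)
    (hg : 1 - g ∈ (⊥ : Ideal (End D)).jacobson) : IsIso (End.asHom g) := by
  have hinv : ∀ r : End D, r - 1 ∈ (⊥ : Ideal (End D)).jacobson → ∃ s, s * r = 1 := fun r hr => by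
    obtain ⟨s, hs⟩ := Ideal.exists_mul_sub_mem_of_sub_one_mem_jacobson r hr
    exact ⟨s, sub_eq_zero.1 hs⟩
  -- The left inverse `s` is itself congruent to 1 modulo the radical, so it has a left inverse too,
  -- which must be `g`.
  obtain ⟨s, hs⟩ := hinv g (by simpa using neg_mem hg)
  obtain ⟨t, ht⟩ := hinv s (by
    have : s - 1 = s * (1 - g) := by rw [mul_sub, mul_one, hs]
    exact this ▸ Ideal.mul_mem_left _ s hg)
  have : t = g := left_inv_eq_right_inv ht hs
  subst this
  exact ⟨s, hs, ht⟩

variable [HasFiniteBiproducts 𝒜]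

lemma eq_sum_components {n : ℕ} {X : Fin n → 𝒜} (f : ⨁ X ⟶ ⨁ X) :
    f = ∑ i, ∑ j, biproduct.π X i ≫ (biproduct.ι X i ≫ f ≫ biproduct.π X j) ≫
      biproduct.ι X j := by
  have h : f = (∑ i, biproduct.π X i ≫ biproduct.ι X i) ≫ f ≫
      ∑ j, biproduct.π X j ≫ biproduct.ι X j := by
    simp only [biproduct.total, Category.id_comp, Category.comp_id]
  simp only [Preadditive.sum_comp, Preadditive.comp_sum, Category.assoc] at h
  rw [Finset.sum_comm] at h
  simpa only [Category.assoc] using h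

/-- Otherwise every component of 1 - g would lie in the Jacobson radical and g would be invertible.
When g fixes a map f, 1 - g kills f, and the isomorphic component locates a summand that f does not
need. -/
lemma exists_isIso_component {n : ℕ} {X : Fin n → 𝒜} (hX : ∀ i, IsLocalRing (End (X i)))
    (g : ⨁ X ⟶ ⨁ X) (hg : ¬ IsIso g) :
    ∃ i j, IsIso (biproduct.ι X i ≫ (𝟙 _ - g) ≫ biproduct.π X j) := by
  by_contra! h
  refine hg (isIso_of_one_sub_mem_jacobson (End.of g) ?_)
  have hsum : 1 - End.of g = ∑ i, ∑ j, End.of (biproduct.π X i ≫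
      (biproduct.ι X i ≫ (𝟙 _ - g) ≫ biproduct.π X j) ≫ biproduct.ι X j) := by
    exact eq_sum_components (𝟙 _ - g)
  rw [hsum]
  exact sum_mem fun i _ => sum_mem fun j _ => mem_jacobson_of_not_isIso _ (h i j) _

section

variable {n : ℕ} (X : Fin (n + 1) → 𝒜) (i : Fin (n + 1))

/-- The projection of `⨁ X` which omits the `i`-th summand. -/
noncomputable def biproductOmitProj : ⨁ X ⟶ ⨁ fun k => X (i.succAbove k) :=
  biproduct.lift fun k => biproduct.π X (i.succAbove k)

/-- The inclusion into `⨁ X` which omits the `i`-th summand. -/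
noncomputable def biproductOmitIncl : (⨁ fun k => X (i.succAbove k)) ⟶ ⨁ X :=
  biproduct.desc fun k => biproduct.ι X (i.succAbove k)

@[simp]
lemma biproductOmitIncl_proj : biproductOmitIncl X i ≫ biproductOmitProj X i = 𝟙 _ := by
  classical
  ext j k
  simp [biproductOmitIncl, biproductOmitProj, biproduct.ι_π]

@[simp]
lemma biproductOmitIncl_π : biproductOmitIncl X i ≫ biproduct.π X i = 0 := by
  classical
  ext k
  simp [biproductOmitIncl]

@[simp]
lemma ι_biproductOmitProj : biproduct.ι X i ≫ biproductOmitProj X i = 0 := by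
  classical
  ext k
  simp [biproductOmitProj, (Fin.succAbove_ne i k).symm]

lemma biproductOmitProj_incl :
    biproductOmitProj X i ≫ biproductOmitIncl X i = 𝟙 _ - biproduct.π X i ≫ biproduct.ι X i := by
  refine eq_sub_of_add_eq (Eq.trans (add_comm _ _) ?_)
  have h := (Fin.sum_univ_succAbove (fun k => biproduct.π X k ≫ biproduct.ι X k) i).symm.trans
    biproduct.total
  refine Eq.trans ?_ h
  simp [biproductOmitIncl, biproductOmitProj, biproduct.lift_desc]

end

lemma IsSubcategory.of_complement {P : ObjectProperty 𝒜} (hP : IsSubcategory P) {D D' E : 𝒜}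
    (hD : P D) (j : D' ⟶ D) (q : D ⟶ D') (k : E ⟶ D) (r : D ⟶ E) (hjq : j ≫ q = 𝟙 D')
    (hkr : k ≫ r = 𝟙 E) (htot : q ≫ j + r ≫ k = 𝟙 D) : P D' := by
  have hjr : j ≫ r = 0 := by
    have : j ≫ (q ≫ j + r ≫ k) ≫ r = j ≫ r + j ≫ r := by simp [reassoc_of% hjq, hkr]
    rw [htot, Category.id_comp] at this
    simpa using this
  have hkq : k ≫ q = 0 := by
    have : k ≫ (q ≫ j + r ≫ k) ≫ q = k ≫ q + k ≫ q := by simp [reassoc_of% hkr, hjq]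
    rw [htot, Category.id_comp] at this
    simpa using this
  exact hP.summand (hP.iso (Y := D' ⊞ E) ⟨biprod.lift q r, biprod.desc j k,
    by simpa [biprod.lift_desc] using htot,
    by ext <;> simp [hjq, hkr, hjr, hkq]⟩ hD)

/-- Induction on the number of summands: while f is not minimal, a projection `r` onto some X i
kills it, and f factors through the other n summands. -/
lemma exists_leftMinimal_biproduct {P : ObjectProperty 𝒜} (hP : IsSubcategory P) {Y : 𝒜} (n : ℕ)
    (X : Fin n → 𝒜) (hX : ∀ i, IsLocalRing (End (X i))) (hD : P (⨁ X)) (f : Y ⟶ ⨁ X) :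
    ∃ (D : 𝒜) (j : D ⟶ ⨁ X) (q : ⨁ X ⟶ D), P D ∧ j ≫ q = 𝟙 D ∧ (f ≫ q) ≫ j = f ∧
      ∀ g : D ⟶ D, (f ≫ q) ≫ g = f ≫ q → IsIso g := by
  by_cases hf : ∀ g : ⨁ X ⟶ ⨁ X, f ≫ g = f → IsIso g
  · exact ⟨_, 𝟙 _, 𝟙 _, hD, by simp, by simp, by simpa using hf⟩
  · push Not at hf
    obtain ⟨g, hfg, hg⟩ := hf
    obtain ⟨i, l, hil⟩ := exists_isIso_component hX g hg
    cases n with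
    | zero => exact i.elim0
    | succ n =>
      obtain ⟨r, hr, hfr⟩ : ∃ r : ⨁ X ⟶ X i, biproduct.ι X i ≫ r = 𝟙 _ ∧ f ≫ r = 0 := by
        have hfh : f ≫ (𝟙 _ - g) = 0 := by simp [hfg]
        generalize 𝟙 (⨁ X) - g = h at hil hfh
        exact ⟨h ≫ biproduct.π X l ≫ inv (biproduct.ι X i ≫ h ≫ biproduct.π X l),
          by simpa only [Category.assoc] using
            IsIso.hom_inv_id (biproduct.ι X i ≫ h ≫ biproduct.π X l),
          by simp [reassoc_of% hfh]⟩
      -- The inclusion of the remaining summands is twisted into the kernel of `r`, so that the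
      -- complementary idempotent is `r ≫ ι` and is annihilated by f.
      let j := biproductOmitIncl X i ≫ (𝟙 _ - r ≫ biproduct.ι X i)
      let q := biproductOmitProj X i
      have hjq : j ≫ q = 𝟙 _ := by simp [j, q]
      have htot : q ≫ j + r ≫ biproduct.ι X i = 𝟙 _ := by
        simp [j, q, reassoc_of% biproductOmitProj_incl, biproductOmitProj_incl, reassoc_of% hr]
      have hfqj : f ≫ q ≫ j = f := by
        have := congr(f ≫ $htot)
        simpa [reassoc_of% hfr] using this
      obtain ⟨D, j', q', hPD, hjq', hf', hmin⟩ := exists_leftMinimal_biproduct hP n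
        (fun k => X (i.succAbove k)) (fun k => hX _)
        (hP.of_complement hD j q (biproduct.ι X i) r hjq hr htot) (f ≫ q)
      refine ⟨D, j' ≫ j, q ≫ q', hPD, by simp [reassoc_of% hjq, hjq'], ?_, fun g => ?_⟩
      · simp only [Category.assoc] at hf' ⊢
        rw [reassoc_of% hf', hfqj]
      · simpa using hmin g

lemma exists_rightMinimal_biproduct {P : ObjectProperty 𝒜} (hP : IsSubcategory P) {Y : 𝒜} (n : ℕ)
    (X : Fin n → 𝒜) (hX : ∀ i, IsLocalRing (End (X i))) (hD : P (⨁ X)) (f : ⨁ X ⟶ Y) :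
    ∃ (D : 𝒜) (j : D ⟶ ⨁ X) (q : ⨁ X ⟶ D), P D ∧ j ≫ q = 𝟙 D ∧ q ≫ j ≫ f = f ∧
      ∀ g : D ⟶ D, g ≫ j ≫ f = j ≫ f → IsIso g := by
  by_cases hf : ∀ g : ⨁ X ⟶ ⨁ X, g ≫ f = f → IsIso g
  · exact ⟨_, 𝟙 _, 𝟙 _, hD, by simp, by simp, by simpa using hf⟩
  · push Not at hf
    obtain ⟨g, hfg, hg⟩ := hf
    obtain ⟨l, i, hil⟩ := exists_isIso_component hX g hg
    cases n with
    | zero => exact i.elim0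
    | succ n =>
      obtain ⟨s, hs, hsf⟩ : ∃ s : X i ⟶ ⨁ X, s ≫ biproduct.π X i = 𝟙 _ ∧ s ≫ f = 0 := by
        have hfh : (𝟙 _ - g) ≫ f = 0 := by simp [hfg]
        generalize 𝟙 (⨁ X) - g = h at hil hfh
        exact ⟨inv (biproduct.ι X l ≫ h ≫ biproduct.π X i) ≫ biproduct.ι X l ≫ h,
          by simp,
          by simp [hfh]⟩
      let j := biproductOmitIncl X i
      let q := (𝟙 _ - biproduct.π X i ≫ s) ≫ biproductOmitProj X i
      have hjq : j ≫ q = 𝟙 _ := by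
        have := biproductOmitIncl_π X i
        simp [j, q, reassoc_of% this]
      have htot : q ≫ j + biproduct.π X i ≫ s = 𝟙 _ := by
        simp [j, q, biproductOmitProj_incl, reassoc_of% hs]
      have hfqj : q ≫ j ≫ f = f := by
        have := congr($htot ≫ f)
        simpa [hsf] using this
      obtain ⟨D, j', q', hPD, hjq', hf', hmin⟩ := exists_rightMinimal_biproduct hP n
        (fun k => X (i.succAbove k)) (fun k => hX _)
        (hP.of_complement hD j q s (biproduct.π X i) hjq hs htot) (j ≫ f)
      refine ⟨D, j' ≫ j, q ≫ q', hPD, by simp [reassoc_of% hjq, hjq'], ?_, fun g => ?_⟩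
      · simp only [Category.assoc] at hf' ⊢
        rw [hf', hfqj]
      · simpa using hmin g

lemma IsKrullSchmidt.exists_leftMinimal (hKS : IsKrullSchmidt 𝒜) {P : ObjectProperty 𝒜}
    (hP : IsSubcategory P) {Y W : 𝒜} (hW : P W) (f : Y ⟶ W) :
    ∃ (D : 𝒜) (j : D ⟶ W) (q : W ⟶ D), P D ∧ j ≫ q = 𝟙 D ∧ (f ≫ q) ≫ j = f ∧
      ∀ g : D ⟶ D, (f ≫ q) ≫ g = f ≫ q → IsIso g := by
  obtain ⟨n, X, hX, ⟨e⟩⟩ := hKS W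
  obtain ⟨D, j, q, hD, hjq, hf, hmin⟩ :=
    exists_leftMinimal_biproduct hP n X hX (hP.iso e hW) (f ≫ e.hom)
  refine ⟨D, j ≫ e.inv, e.hom ≫ q, hD, by simp [hjq], ?_, by simpa using hmin⟩
  rw [← cancel_mono e.hom, ← hf]
  simp

lemma IsKrullSchmidt.exists_rightMinimal (hKS : IsKrullSchmidt 𝒜) {P : ObjectProperty 𝒜}
    (hP : IsSubcategory P) {Y W : 𝒜} (hW : P W) (f : W ⟶ Y) :
    ∃ (D : 𝒜) (j : D ⟶ W) (q : W ⟶ D), P D ∧ j ≫ q = 𝟙 D ∧ q ≫ j ≫ f = f ∧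
      ∀ g : D ⟶ D, g ≫ j ≫ f = j ≫ f → IsIso g := by
  obtain ⟨n, X, hX, ⟨e⟩⟩ := hKS W
  obtain ⟨D, j, q, hD, hjq, hf, hmin⟩ :=
    exists_rightMinimal_biproduct hP n X hX (hP.iso e hW) (e.inv ≫ f)
  refine ⟨D, j ≫ e.inv, e.hom ≫ q, hD, by simp [hjq], ?_, by simpa using hmin⟩
  rw [← cancel_epi e.inv, ← hf]
  simp

end KrullSchmidt

namespace Extriangulated

variable {𝒜 : Type u} [Category.{v} 𝒜] [Preadditive 𝒜] [HasFiniteBiproducts 𝒜]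
  {T : Extriangulated.{w} 𝒜}

/-! ## Wakamatsu's lemma -/

/-- The middle term E of `pull q θ` lies in 𝒟, and `f` lifts to E. The lift factors through `f`,
giving an endomorphism of D that fixes `f`; minimality makes it invertible, so the extension splits.
Hence θ is pushed out along some Y → D', which factors through `f`, so θ = 0. -/
lemma extVanish_cone_of_leftMinimal {𝒟 : ObjectProperty 𝒜}
    (hext : ∀ {A B C : 𝒜} (x : A ⟶ B) (y : B ⟶ C), T.Conflation x y → 𝒟 A → 𝒟 C → 𝒟 B)
    {Y D V : 𝒜} {f : Y ⟶ D} {q : D ⟶ V} (h : T.Conflation f q) (hf : IsLeftApprox 𝒟 f)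
    (hmin : ∀ g : D ⟶ D, f ≫ g = f → IsIso g) {D' : 𝒜} (hD' : 𝒟 D') : T.ExtVanish V D' := by
  intro θ
  obtain ⟨δ, hδ⟩ := h
  have key : pull q θ = 0 := by
    obtain ⟨E, i, e, hE⟩ := exists_tri (pull q θ)
    obtain ⟨f', hf'⟩ := exists_lift_of_pull_eq_zero hE f (by
      rw [← pull_comp, comp_eq_zero hδ, zero_pull])
    obtain ⟨k, hk⟩ := hf.2 E f' (hext i e ⟨_, hE⟩ hD' hf.1)
    have := hmin (k ≫ e) (by rw [← Category.assoc, hk, hf'])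
    exact eq_zero_of_section hE (s := inv (k ≫ e) ≫ k) (by simp)
  obtain ⟨a, rfl⟩ := exists_eq_push hδ θ key
  obtain ⟨b, rfl⟩ := hf.2 _ a hD'
  rw [push_comp, push_inflation hδ, push_zero]

lemma extVanish_fibre_of_rightMinimal {ℬ : ObjectProperty 𝒜}
    (hext : ∀ {A B C : 𝒜} (x : A ⟶ B) (y : B ⟶ C), T.Conflation x y → ℬ A → ℬ C → ℬ B)
    {K B Y : 𝒜} {k : K ⟶ B} {f : B ⟶ Y} (h : T.Conflation k f) (hf : IsRightApprox ℬ f)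
    (hmin : ∀ g : B ⟶ B, g ≫ f = f → IsIso g) {B' : 𝒜} (hB' : ℬ B') : T.ExtVanish B' K := by
  intro θ
  obtain ⟨δ, hδ⟩ := h
  have key : push k θ = 0 := by
    obtain ⟨E, i, e, hE⟩ := exists_tri (push k θ)
    obtain ⟨f', hf'⟩ := exists_extension_of_push_eq_zero hE f (by
      rw [← push_comp, comp_eq_zero hδ, zero_push])
    obtain ⟨l, hl⟩ := hf.2 E f' (hext i e ⟨_, hE⟩ hf.1 hB')
    have := hmin (i ≫ l) (by rw [Category.assoc, hl, hf'])
    exact eq_zero_of_retraction hE (r := l ≫ inv (i ≫ l)) (by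
      rw [← Category.assoc, IsIso.hom_inv_id])
  obtain ⟨a, rfl⟩ := exists_eq_pull hδ θ key
  obtain ⟨b, rfl⟩ := hf.2 _ a hB'
  rw [pull_comp, pull_deflation hδ, pull_zero]

lemma exists_minimal_leftApprox (hKS : IsKrullSchmidt 𝒜) (hWIC : T.WIC) {𝒟 : ObjectProperty 𝒜}
    (h𝒟 : IsSubcategory 𝒟) {Y W V : 𝒜} {f : Y ⟶ W} {y : W ⟶ V} (h : T.Conflation f y)
    (hf : IsLeftApprox 𝒟 f) :
    ∃ (D V' : 𝒜) (f' : Y ⟶ D) (q : D ⟶ V'), T.Conflation f' q ∧ IsLeftApprox 𝒟 f' ∧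
      ∀ g : D ⟶ D, f' ≫ g = f' → IsIso g := by
  obtain ⟨D, j, q, hD, hjq, hfj, hmin⟩ := hKS.exists_leftMinimal h𝒟 hf.1 f
  -- The original inflation is the minimal part followed by the split inclusion `j`, so (WIC)
  -- applies to its first factor.
  obtain ⟨V', p, hp⟩ := hWIC.1 (f ≫ q) j (hfj.symm ▸ (⟨V, y, h⟩ : T.Inflation f))
  refine ⟨D, V', f ≫ q, p, hp, ⟨hD, fun W' a hW' => ?_⟩, hmin⟩
  obtain ⟨b, hb⟩ := hf.2 W' a hW'
  exact ⟨j ≫ b, by rw [← Category.assoc, hfj, hb]⟩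

lemma exists_minimal_rightApprox (hKS : IsKrullSchmidt 𝒜) (hWIC : T.WIC) {ℬ : ObjectProperty 𝒜}
    (hℬ : IsSubcategory ℬ) {K W Y : 𝒜} {x : K ⟶ W} {f : W ⟶ Y} (h : T.Conflation x f)
    (hf : IsRightApprox ℬ f) :
    ∃ (K' B : 𝒜) (k : K' ⟶ B) (f' : B ⟶ Y), T.Conflation k f' ∧ IsRightApprox ℬ f' ∧
      ∀ g : B ⟶ B, g ≫ f' = f' → IsIso g := by
  obtain ⟨B, j, q, hB, hjq, hfj, hmin⟩ := hKS.exists_rightMinimal hℬ hf.1 f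
  obtain ⟨K', k, hk⟩ := hWIC.2 q (j ≫ f) (hfj.symm ▸ (⟨K, x, h⟩ : T.Deflation f))
  refine ⟨K', B, k, j ≫ f, hk, ⟨hB, fun W' a hW' => ?_⟩, hmin⟩
  obtain ⟨b, hb⟩ := hf.2 W' a hW'
  exact ⟨b ≫ q, by rw [Category.assoc, hfj, hb]⟩

variable [T.EnoughInjectives]

/-- The special conflation of Y splits by orthogonality, so Y is a summand of an object of 𝒟. -/
lemma rightPerp_leftPerp_eq {𝒟 𝒴 : ObjectProperty 𝒜} (h𝒟 : IsSubcategory 𝒟) (hle : 𝒟 ≤ 𝒴)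
    (hspecial : ∀ Y, 𝒴 Y → ∃ (D B : 𝒜) (f : Y ⟶ D) (q : D ⟶ B),
      T.Conflation f q ∧ 𝒟 D ∧ (T.leftPerp 𝒟 ⊓ 𝒴) B) :
    T.rightPerp (T.leftPerp 𝒟 ⊓ 𝒴) ⊓ 𝒴 = 𝒟 := by
  refine le_antisymm (fun Y hY => ?_) fun D hD => ⟨fun B hB => hB.1 D hD, hle _ hD⟩
  obtain ⟨D, B, f, q, hfq, hD, hB⟩ := hspecial Y hY.2
  obtain ⟨e⟩ := ExtVanish.nonempty_iso (hY.1 B hB 0) hfq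
  exact h𝒟.summand (h𝒟.iso e hD)

lemma leftPerp_rightPerp_eq {ℬ 𝒴 : ObjectProperty 𝒜} (hℬ : IsSubcategory ℬ) (hle : ℬ ≤ 𝒴)
    (hspecial : ∀ Y, 𝒴 Y → ∃ (D B : 𝒜) (k : D ⟶ B) (f : B ⟶ Y),
      T.Conflation k f ∧ ℬ B ∧ (T.rightPerp ℬ ⊓ 𝒴) D) :
    T.leftPerp (T.rightPerp ℬ ⊓ 𝒴) ⊓ 𝒴 = ℬ := by
  refine le_antisymm (fun Y hY => ?_) fun B hB => ⟨fun D hD => hD.1 B hB, hle _ hB⟩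
  obtain ⟨D, B, k, f, hkf, hB, hD⟩ := hspecial Y hY.2
  obtain ⟨e⟩ := ExtVanish.nonempty_iso (hY.1 D hD 0) hkf
  exact hℬ.summand_right (hℬ.iso e hB)

variable [T.EnoughProjectives] {𝒞 ℐ 𝒟 ℬ : ObjectProperty 𝒜}

/-! ## Special approximations -/

lemma IsRelCoresolving.exists_specialLeft (hKS : IsKrullSchmidt 𝒜) (hWIC : T.WIC)
    (h𝒞 : IsSubcategory 𝒞) (hcog : T.IsRelInjCogenerator ℐ (T.properResolved 𝒞))
    (h : T.IsRelCoresolving 𝒟 (T.properResolved 𝒞))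
    (hfin : T.StronglyCovariantlyFinite 𝒟 (T.properResolved 𝒞)) {Y : 𝒜}
    (hY : T.properResolved 𝒞 Y) :
    ∃ (D B : 𝒜) (f : Y ⟶ D) (q : D ⟶ B), T.Conflation f q ∧ 𝒟 D ∧
      (T.leftPerp 𝒟 ⊓ T.properResolved 𝒞) B := by
  obtain ⟨W, V, g, y, -, hgy, hg⟩ := hfin Y hY
  obtain ⟨D, B, f, q, hfq, hf, hmin⟩ := exists_minimal_leftApprox hKS hWIC h.isSubcategory hgy hg
  have hB : T.properResolved 𝒞 B := properResolved_cone h𝒞 hfq hY (h.le _ hf.1)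
  have h0 : ∀ D', 𝒟 D' → T.ExtVanish B D' := fun D' hD' =>
    extVanish_cone_of_leftMinimal (fun x y hxy hA hC =>
      h.ext x y hxy (properResolved_middle h𝒞 hxy (h.le _ hA) (h.le _ hC)) hA hC) hfq hf hmin hD'
  refine ⟨D, B, f, q, hfq, hf.1, fun D' hD' i => ?_, hB⟩
  induction i generalizing D' with
  | zero => exact h0 D' hD'
  | succ i ih =>
    -- Coresolving puts Y' in 𝒟, and extensions from B to I vanish in all degrees; the vanishing for
    -- Y' in one degree thus gives that for D' in the next.
    obtain ⟨I, Y', a, b, hI, hY', hab⟩ := hcog.exists_conflation D' (h.le _ hD')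
    exact HigherExtVanish.fibre_right hab
      (ih Y' (h.cone a b hab hY' hD' (h.inj _ (hcog.le_injIn _ hI))))
      ((hcog.le _ hI).2 B hB (i + 1))

lemma IsRelResolving.exists_specialRight (hKS : IsKrullSchmidt 𝒜) (hWIC : T.WIC)
    (h𝒞 : IsSubcategory 𝒞) (hself : T.SelfOrthogonal 𝒞)
    (h : T.IsRelResolving ℬ (T.properResolved 𝒞))
    (hfin : T.StronglyContravariantlyFinite ℬ (T.properResolved 𝒞)) {Y : 𝒜}
    (hY : T.properResolved 𝒞 Y) :
    ∃ (D B : 𝒜) (k : D ⟶ B) (f : B ⟶ Y), T.Conflation k f ∧ ℬ B ∧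
      (T.rightPerp ℬ ⊓ T.properResolved 𝒞) D := by
  have hle : 𝒞 ≤ ℬ := (le_projIn h𝒞 hself).trans h.proj
  obtain ⟨W, V, g, y, -, hgy, hg⟩ := hfin Y hY
  obtain ⟨D, B, k, f, hkf, hf, hmin⟩ := exists_minimal_rightApprox hKS hWIC h.isSubcategory hgy hg
  -- Membership in 𝒞^⊥ must come before membership in 𝒳, since fibres stay in 𝒳 only under that
  -- condition. Maps from 𝒞 lift because 𝒞 ⊆ ℬ and `f` is a right ℬ-approximation.
  have hD : T.rightPerp 𝒞 D := rightPerp_fibre hkf (properResolved_le_rightPerp _ (h.le _ hf.1))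
    (properResolved_le_rightPerp _ hY) fun W hW c => hf.2 W c (hle _ hW)
  have h0 : ∀ B', ℬ B' → T.ExtVanish B' D := fun B' hB' =>
    extVanish_fibre_of_rightMinimal (fun x y hxy hA hC =>
      h.ext x y hxy (properResolved_middle h𝒞 hxy (h.le _ hA) (h.le _ hC)) hA hC) hkf hf hmin hB'
  refine ⟨D, B, k, f, hkf, hf.1, fun B' hB' i => ?_,
    properResolved_fibre h𝒞 hself hkf hD (h.le _ hf.1) hY⟩
  induction i generalizing B' with
  | zero => exact h0 B' hB'
  | succ i ih =>
    obtain ⟨K, W, a, b, hK, hW, hab⟩ := exists_conflation_of_properResolved (h.le _ hB')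
    exact HigherExtVanish.cone_left hab (ih K (h.cocone a b hab hK (hle _ hW) hB'))
      (hD W hW (i + 1))

/-! ## The two assignments -/

lemma isRelResolving_leftPerp (h𝒞 : IsSubcategory 𝒞) (hself : T.SelfOrthogonal 𝒞)
    (h𝒟 : 𝒟 ≤ T.properResolved 𝒞) :
    T.IsRelResolving (T.leftPerp 𝒟 ⊓ T.properResolved 𝒞) (T.properResolved 𝒞) where
  isSubcategory := (leftPerp_isSubcategory _).inf (properResolved_isSubcategory h𝒞 hself)
  le := inf_le_right
  ext _ _ h hB hA hC :=
    ⟨fun D hD i => HigherExtVanish.middle_left h (hA.1 D hD i) (hC.1 D hD i), hB⟩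
  cocone _ _ h hA hB hC :=
    ⟨fun D hD i => HigherExtVanish.fibre_left h (hB.1 D hD i) (hC.1 D hD (i + 1)), hA⟩
  proj := le_inf ((projIn_le h𝒞 hself).trans ((le_leftPerp_rightPerp 𝒞).trans
    (leftPerp_antitone (h𝒟.trans properResolved_le_rightPerp)))) fun _ hP => hP.1

lemma isRelCoresolving_rightPerp (h𝒞 : IsSubcategory 𝒞) (hself : T.SelfOrthogonal 𝒞)
    (hcog : T.IsRelInjCogenerator ℐ (T.properResolved 𝒞)) (hℬ : ℬ ≤ T.properResolved 𝒞) :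
    T.IsRelCoresolving (T.rightPerp ℬ ⊓ T.properResolved 𝒞) (T.properResolved 𝒞) where
  isSubcategory := (rightPerp_isSubcategory _).inf (properResolved_isSubcategory h𝒞 hself)
  le := inf_le_right
  ext _ _ h hB hA hC := ⟨rightPerp_middle h hA.1 hC.1, hB⟩
  cone _ _ h hC hA hB := ⟨rightPerp_cone h hA.1 hB.1, hC⟩
  inj := fun _ hJ => ⟨fun B hB i => (hcog.le _ (hcog.injIn_le _ hJ)).2 B (hℬ _ hB) i, hJ.1⟩

lemma stronglyContravariantlyFinite_leftPerp (h𝒞 : IsSubcategory 𝒞) (hself : T.SelfOrthogonal 𝒞)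
    (h𝒟 : 𝒟 ≤ T.properResolved 𝒞)
    (hspecial : ∀ Y, T.properResolved 𝒞 Y → ∃ (D B : 𝒜) (f : Y ⟶ D) (q : D ⟶ B),
      T.Conflation f q ∧ 𝒟 D ∧ (T.leftPerp 𝒟 ⊓ T.properResolved 𝒞) B) :
    T.StronglyContravariantlyFinite (T.leftPerp 𝒟 ⊓ T.properResolved 𝒞)
      (T.properResolved 𝒞) := by
  intro Y hY
  have hres := isRelResolving_leftPerp h𝒞 hself h𝒟
  obtain ⟨K, W, k, p, hK, hW, hkp⟩ := exists_conflation_of_properResolved hY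
  obtain ⟨D, B, f, q, hfq, hD, hB⟩ := hspecial K hK
  -- Salce's argument: M is an extension of B by W, hence in ^⊥𝒟 ∩ 𝒳, while the fibre of M → Y is D,
  -- so orthogonality makes this deflation an approximation.
  obtain ⟨M, m₁, e₂, m₂, e₁, hM₁, hM₂⟩ := exists_pushout hkp hfq
  have hW' := hres.proj _ (le_projIn h𝒞 hself _ hW)
  refine ⟨D, M, m₂, e₁, h𝒟 _ hD, hM₂, ?_, fun B' c hB' => ?_⟩
  · exact hres.ext m₁ e₂ hM₁ (properResolved_middle h𝒞 hM₁ hW'.2 hB.2) hW' hB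
  · exact ExtVanish.exists_lift (hB'.1 D hD 0) hM₂ c

lemma stronglyCovariantlyFinite_rightPerp (h𝒞 : IsSubcategory 𝒞) (hself : T.SelfOrthogonal 𝒞)
    (hcog : T.IsRelInjCogenerator ℐ (T.properResolved 𝒞)) (hℬ : ℬ ≤ T.properResolved 𝒞)
    (hspecial : ∀ Y, T.properResolved 𝒞 Y → ∃ (D B : 𝒜) (k : D ⟶ B) (f : B ⟶ Y),
      T.Conflation k f ∧ ℬ B ∧ (T.rightPerp ℬ ⊓ T.properResolved 𝒞) D) :
    T.StronglyCovariantlyFinite (T.rightPerp ℬ ⊓ T.properResolved 𝒞) (T.properResolved 𝒞) := by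
  intro Y hY
  have hres := isRelCoresolving_rightPerp h𝒞 hself hcog hℬ
  obtain ⟨I, Y', x, y, hI, hY', hxy⟩ := hcog.exists_conflation Y hY
  obtain ⟨D, B, k, f, hkf, hB, hD⟩ := hspecial Y' hY'
  -- Dually, M is an extension of I by D, hence in ℬ^⊥ ∩ 𝒳, and the cone of Y → M is B.
  obtain ⟨M, m₁, e₂, m₂, e₁, hM₁, hM₂⟩ := exists_pullback hxy hkf
  have hI' := hres.inj _ (hcog.le_injIn _ hI)
  refine ⟨M, B, m₁, e₂, hℬ _ hB, hM₁, ?_, fun D' a hD' => ?_⟩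
  · exact hres.ext m₂ e₁ hM₂ (properResolved_middle h𝒞 hM₂ hD.2 hI'.2) hD hI'
  · exact ExtVanish.exists_desc (hD'.1 B hB 0) hM₁ a

end Extriangulated
end Extri

theorem mainTheorem4 {𝒜 : Type u} [Category.{v} 𝒜] [Preadditive 𝒜] [HasFiniteBiproducts 𝒜]
    (T : Extri.Extriangulated.{w} 𝒜) [T.EnoughProjectives] [T.EnoughInjectives]
    (hKS : Extri.IsKrullSchmidt 𝒜) (hWIC : T.WIC)
    (𝒞 : ObjectProperty 𝒜) (h𝒞 : Extri.IsSubcategory 𝒞) (hself : T.SelfOrthogonal 𝒞)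
    (hcog : ∃ ℐ : ObjectProperty 𝒜, T.IsRelInjCogenerator ℐ (T.properResolved 𝒞)) :
    let 𝒳 : ObjectProperty 𝒜 := T.properResolved 𝒞
    let coresolving : Set (ObjectProperty 𝒜) :=
      {𝒟 | T.IsRelCoresolving 𝒟 𝒳 ∧ T.StronglyCovariantlyFinite 𝒟 𝒳}
    let resolving : Set (ObjectProperty 𝒜) :=
      {ℬ | T.IsRelResolving ℬ 𝒳 ∧ T.StronglyContravariantlyFinite ℬ 𝒳}
    let Φ : ObjectProperty 𝒜 → ObjectProperty 𝒜 := fun 𝒟 => T.leftPerp 𝒟 ⊓ 𝒳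
    let Ψ : ObjectProperty 𝒜 → ObjectProperty 𝒜 := fun ℬ => T.rightPerp ℬ ⊓ 𝒳
    Set.BijOn Φ coresolving resolving ∧ Set.BijOn Ψ resolving coresolving ∧
      Set.InvOn Ψ Φ coresolving resolving := by
  obtain ⟨ℐ, hℐ⟩ := hcog
  intro 𝒳 coresolving resolving Φ Ψ
  have hleft : ∀ 𝒟 ∈ coresolving, ∀ Y, 𝒳 Y → _ := fun 𝒟 h𝒟 Y hY =>
    h𝒟.1.exists_specialLeft hKS hWIC h𝒞 hℐ h𝒟.2 hY
  have hright : ∀ ℬ ∈ resolving, ∀ Y, 𝒳 Y → _ := fun ℬ hℬ Y hY =>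
    hℬ.1.exists_specialRight hKS hWIC h𝒞 hself hℬ.2 hY
  have hΦ : Set.MapsTo Φ coresolving resolving := fun 𝒟 h𝒟 =>
    ⟨Extri.Extriangulated.isRelResolving_leftPerp h𝒞 hself h𝒟.1.le,
      Extri.Extriangulated.stronglyContravariantlyFinite_leftPerp h𝒞 hself h𝒟.1.le (hleft 𝒟 h𝒟)⟩
  have hΨ : Set.MapsTo Ψ resolving coresolving := fun ℬ hℬ =>
    ⟨Extri.Extriangulated.isRelCoresolving_rightPerp h𝒞 hself hℐ hℬ.1.le,
      Extri.Extriangulated.stronglyCovariantlyFinite_rightPerp h𝒞 hself hℐ hℬ.1.le (hright ℬ hℬ)⟩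
  have hinv : Set.InvOn Ψ Φ coresolving resolving :=
    ⟨fun 𝒟 h𝒟 => Extri.Extriangulated.rightPerp_leftPerp_eq h𝒟.1.isSubcategory h𝒟.1.le (hleft 𝒟 h𝒟),
      fun ℬ hℬ =>
        Extri.Extriangulated.leftPerp_rightPerp_eq hℬ.1.isSubcategory hℬ.1.le (hright ℬ hℬ)⟩
  exact ⟨hinv.bijOn hΦ hΨ, hinv.symm.bijOn hΨ hΦ, hinv⟩
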